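/- Let $C\subset\mathbb{P}^4$ be the closed subscheme over $\mathbb{F}_3$ defined, in homogeneous coordinates $(x_1:x_2:x_3:x_4:x_5)$, by the three quadratic forms $$q_1=2x_1x_2+x_3x_2+x_3^2-x_4^2,\qquad q_2=x_5x_1-x_4x_2,\qquad q_3=x_1^2+x_1x_2-x_3^2+x_5^2.$$ Then $C$ is a smooth, geometrically irreducible projective curve over $\mathbb{F}_3$, its genus $\dim_{\mathbb{F}_3}H^1(C,\mathcal{O}_C)$ is $5$, and $C$ has exactly $13$ $\mathbb{F}_3$-rational points. -/

import Mathlib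

open CategoryTheory AlgebraicGeometry

universe u

noncomputable section

namespace GenusFive

/-! ### Cohomology of the structure sheaf and the genus -/

/-- The structure sheaf of a scheme, as a sheaf of abelian groups. -/
def additiveStructureSheaf (X : Scheme.{u}) :
    Sheaf (Opens.grothendieckTopology X) AddCommGrpCat.{u} :=
  (sheafCompose _ (forget₂ RingCat.{u} AddCommGrpCat.{u})).obj X.ringCatSheaf

/-- Multiplication by a global function, as an endomorphism of the structure sheaf. -/
def mulGlobal (X : Scheme.{u}) (a : Γ(X, ⊤)) :
    additiveStructureSheaf X ⟶ additiveStructureSheaf X where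
  hom :=
    { app := fun U => AddCommGrpCat.ofHom
        (AddMonoidHom.mulLeft (R := Γ(X, U.unop)) (X.presheaf.map (homOfLE le_top).op a))
      naturality := by
        intro U V i
        ext s
        change X.presheaf.map (homOfLE le_top).op a *
            X.presheaf.map i (show Γ(X, U.unop) from s) =
          X.presheaf.map i
            (X.presheaf.map (homOfLE le_top).op a * (show Γ(X, U.unop) from s))
        rw [map_mul, ← CommRingCat.comp_apply, ← X.presheaf.map_comp]
        rfl }

lemma mulGlobal_one (X : Scheme.{u}) : mulGlobal X 1 = 𝟙 _ := by
  ext U s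
  change X.presheaf.map (homOfLE le_top).op 1 * (show Γ(X, U.unop) from s) = s
  rw [map_one]
  exact one_mul (show Γ(X, U.unop) from s)

lemma mulGlobal_mul (X : Scheme.{u}) (a b : Γ(X, ⊤)) :
    mulGlobal X (a * b) = mulGlobal X b ≫ mulGlobal X a := by
  ext U s
  change X.presheaf.map (homOfLE le_top).op (a * b) * (show Γ(X, U.unop) from s) =
    X.presheaf.map (homOfLE le_top).op a *
      (X.presheaf.map (homOfLE le_top).op b * (show Γ(X, U.unop) from s))
  rw [map_mul, mul_assoc]

lemma mulGlobal_add (X : Scheme.{u}) (a b : Γ(X, ⊤)) :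
    mulGlobal X (a + b) = mulGlobal X a + mulGlobal X b := by
  ext U s
  change X.presheaf.map (homOfLE le_top).op (a + b) * (show Γ(X, U.unop) from s) =
    X.presheaf.map (homOfLE le_top).op a * (show Γ(X, U.unop) from s) +
      X.presheaf.map (homOfLE le_top).op b * (show Γ(X, U.unop) from s)
  rw [map_add, add_mul]

/-- The sheaf cohomology group `Hⁿ(X, 𝒪_X)`. -/
abbrev structureCohomology (X : Scheme.{u}) (n : ℕ) : Type u :=
  Sheaf.H.{u} (additiveStructureSheaf X) n

/-- The action of global functions on `Hⁿ(X, 𝒪_X)`, by functoriality of cohomology. -/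
def globalAction (X : Scheme.{u}) (n : ℕ) :
    Γ(X, ⊤) →+* AddMonoid.End (structureCohomology X n) where
  toFun a := Sheaf.H.map (mulGlobal X a) n
  map_one' := by
    rw [mulGlobal_one]
    exact AddMonoidHom.ext fun x => Sheaf.H.map_id_apply x
  map_mul' a b := by
    rw [mulGlobal_mul]
    exact AddMonoidHom.ext fun x => Sheaf.H.map_comp_apply _ _ x
  map_zero' := by
    have h : mulGlobal X 0 = 0 := by simpa using mulGlobal_add X 0 0
    rw [h]
    refine AddMonoidHom.ext fun x => ?_
    change Sheaf.H.map (0 : additiveStructureSheaf X ⟶ _) n x = 0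
    simpa using Sheaf.H.map_add_apply (0 : additiveStructureSheaf X ⟶ _) 0 x
  map_add' a b := by
    rw [mulGlobal_add]
    exact AddMonoidHom.ext fun x => Sheaf.H.map_add_apply _ _ x

/-- For a scheme `f : X ⟶ Spec k`, the structure map `k → Γ(X, 𝒪_X)`. -/
def scalarsToGlobal {k : Type u} [CommRing k] {X : Scheme.{u}} (f : X ⟶ Spec (.of k)) :
    k →+* Γ(X, ⊤) :=
  ((Scheme.ΓSpecIso (.of k)).inv ≫ f.appTop).hom

/-- The `k`-module structure on `Hⁿ(X, 𝒪_X)` for a scheme `f : X ⟶ Spec k`. -/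
abbrev structureCohomologyModule {k : Type u} [CommRing k] {X : Scheme.{u}}
    (f : X ⟶ Spec (.of k)) (n : ℕ) : Module k (structureCohomology X n) :=
  Module.compHom _ ((globalAction X n).comp (scalarsToGlobal f))

/-- The dimension of `Hⁿ(X, 𝒪_X)` over `k`. -/
def cohomologyDim {k : Type u} [Field k] {X : Scheme.{u}} (f : X ⟶ Spec (.of k)) (n : ℕ) :
    Cardinal.{u} :=
  letI := structureCohomologyModule f n
  Module.rank k (structureCohomology X n)

/-- `X`, with structure morphism `f : X ⟶ Spec k`, is a (projective) smooth curve over the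
field `k`: it is proper, smooth of relative dimension one and geometrically irreducible. -/
structure IsSmoothCurve {k : Type u} [Field k] {X : Scheme.{u}} (f : X ⟶ Spec (.of k)) :
    Prop where
  proper : IsProper f
  smooth : SmoothOfRelativeDimension 1 f
  geomIrreducible : GeometricallyIrreducible f

/-- A scheme over `k` has genus `g` if `dim_k H¹(X, 𝒪_X) = g`. -/
def HasGenus {k : Type u} [Field k] {X : Scheme.{u}} (f : X ⟶ Spec (.of k)) (g : ℕ) : Prop :=
  cohomologyDim f 1 = g

/-- The `k`-rational points of a scheme `f : X ⟶ Spec k`: the sections of `f`. -/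
def RationalPoint {k : Type u} [Field k] {X : Scheme.{u}} (f : X ⟶ Spec (.of k)) : Type u :=
  {s : Spec (.of k) ⟶ X // s ≫ f = 𝟙 _}

/-! ### Closed subschemes of projective space -/

section Quotient

open DirectSum

variable {k A : Type u} [CommRing k] [CommRing A] [Algebra k A]
  (𝒜 : ℕ → Submodule k A) [GradedAlgebra 𝒜]

/-- The grading of `A / I` induced by a grading of `A`: the degree `n` part is the image of the
degree `n` part of `A`. -/
def quotientGrading (I : Ideal A) (n : ℕ) : Submodule k (A ⧸ I) :=
  (𝒜 n).map (Ideal.Quotient.mkₐ k I).toLinearMap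

instance (I : Ideal A) : SetLike.GradedMonoid (quotientGrading 𝒜 I) where
  one_mem := ⟨1, SetLike.GradedOne.one_mem, map_one (Ideal.Quotient.mk I)⟩
  mul_mem := by
    rintro i j _ _ ⟨a, ha, rfl⟩ ⟨b, hb, rfl⟩
    exact ⟨a * b, SetLike.GradedMul.mul_mem ha hb, map_mul (Ideal.Quotient.mk I) a b⟩

/-- Decompose an element of `A` and pass to classes modulo `I`. -/
def toQuotientPieces (I : Ideal A) : A →ₗ[k] ⨁ n, quotientGrading 𝒜 I n :=
  (DirectSum.lmap fun n => (Ideal.Quotient.mkₐ k I).toLinearMap.submoduleMap (𝒜 n)) ∘ₗ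
    (DirectSum.decomposeLinearEquiv 𝒜).toLinearMap

lemma toQuotientPieces_apply (I : Ideal A) (a : A) (n : ℕ) :
    (toQuotientPieces 𝒜 I a n : A ⧸ I) = Ideal.Quotient.mk I (decompose 𝒜 a n) := rfl

lemma toQuotientPieces_eq_zero {I : Ideal A} (hI : I.IsHomogeneous 𝒜) {a : A} (ha : a ∈ I) :
    toQuotientPieces 𝒜 I a = 0 := by
  ext n
  rw [toQuotientPieces_apply]
  exact Ideal.Quotient.eq_zero_iff_mem.mpr (hI n ha)

lemma toQuotientPieces_mem {I : Ideal A} {n : ℕ} {a : A} (ha : a ∈ 𝒜 n) :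
    toQuotientPieces 𝒜 I a =
      DirectSum.of (fun n => quotientGrading 𝒜 I n) n ⟨Ideal.Quotient.mk I a, a, ha, rfl⟩ := by
  change DirectSum.lmap _ (decompose 𝒜 a) = _
  rw [decompose_of_mem 𝒜 ha]
  exact DirectSum.lmap_lof _ _ _

lemma sum_toQuotientPieces (I : Ideal A) (a : A) :
    DirectSum.coeLinearMap (quotientGrading 𝒜 I) (toQuotientPieces 𝒜 I a) =
      Ideal.Quotient.mk I a := by
  induction a using DirectSum.Decomposition.inductionOn 𝒜 with
  | zero => simp
  | @homogeneous n m =>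
    rw [toQuotientPieces_mem 𝒜 m.2]
    exact DirectSum.coeLinearMap_lof _ _ _
  | add a b ha hb => rw [map_add, map_add, map_add, ha, hb]

lemma toQuotientPieces_congr {I : Ideal A} (hI : I.IsHomogeneous 𝒜) {a b : A}
    (h : Ideal.Quotient.mk I a = Ideal.Quotient.mk I b) :
    toQuotientPieces 𝒜 I a = toQuotientPieces 𝒜 I b := by
  rw [← sub_add_cancel a b, map_add, toQuotientPieces_eq_zero 𝒜 hI (Ideal.Quotient.eq.mp h),
    zero_add]

/-- The quotient of a graded algebra by a homogeneous ideal is graded. -/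
@[reducible] def quotientGradedAlgebra {I : Ideal A} (hI : I.IsHomogeneous 𝒜) :
    GradedAlgebra (quotientGrading 𝒜 I) where
  decompose' x := toQuotientPieces 𝒜 I (Function.surjInv Ideal.Quotient.mk_surjective x)
  left_inv x := (sum_toQuotientPieces 𝒜 I _).trans (Function.surjInv_eq _ x)
  right_inv x := by
    induction x using DirectSum.induction_on with
    | zero =>
      rw [map_zero, ← map_zero (toQuotientPieces 𝒜 I)]
      refine toQuotientPieces_congr 𝒜 hI ?_
      exact (Function.surjInv_eq Ideal.Quotient.mk_surjective _).trans (map_zero _).symm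
    | of n x =>
      obtain ⟨_, a, ha, rfl⟩ := x
      rw [DirectSum.coeAddMonoidHom_of]
      refine Eq.trans (toQuotientPieces_congr 𝒜 hI ?_) (toQuotientPieces_mem 𝒜 ha)
      exact Function.surjInv_eq _ _
    | add x y hx hy =>
      refine Eq.trans ?_ (congrArg₂ (· + ·) hx hy)
      rw [← map_add (toQuotientPieces 𝒜 I)]
      refine toQuotientPieces_congr 𝒜 hI ?_
      have h (z : A ⧸ I) : Ideal.Quotient.mk I
          (Function.surjInv Ideal.Quotient.mk_surjective z) = z := Function.surjInv_eq _ z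
      rw [map_add (Ideal.Quotient.mk I), h, h, h, map_add]

/-- The structure morphism `Proj 𝒜 ⟶ Spec k` for a graded `k`-algebra. -/
def projStructure : Proj 𝒜 ⟶ Spec (.of k) :=
  Proj.toSpecZero 𝒜 ≫ Spec.map (CommRingCat.ofHom (algebraMap k (𝒜 0)))

end Quotient

section ProjectiveSpace

open MvPolynomial

attribute [local instance] MvPolynomial.gradedAlgebra

variable {k : Type} [Field k] {m r : ℕ}

lemma isHomogeneous_span {q : Fin r → MvPolynomial (Fin m) k} {d : Fin r → ℕ}
    (hq : ∀ j, (q j).IsHomogeneous (d j)) :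
    (Ideal.span (Set.range q)).IsHomogeneous (homogeneousSubmodule (Fin m) k) := by
  refine Ideal.homogeneous_span _ _ ?_
  rintro _ ⟨j, rfl⟩
  exact ⟨d j, hq j⟩

/-- The grading by degree of the homogeneous coordinate ring `k[x₀, …, x_{m-1}] / (q₁, …, q_r)`. -/
abbrev coordinateGrading (q : Fin r → MvPolynomial (Fin m) k) :
    ℕ → Submodule k (MvPolynomial (Fin m) k ⧸ Ideal.span (Set.range q)) :=
  quotientGrading (homogeneousSubmodule (Fin m) k) (Ideal.span (Set.range q))

/-- The closed subscheme `Proj k[x₀, …, x_{m-1}] / (q₁, …, q_r)` of the projective space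
`Proj k[x₀, …, x_{m-1}]` cut out by the homogeneous polynomials `q₁, …, q_r`. -/
def zeroLocus (q : Fin r → MvPolynomial (Fin m) k) {d : Fin r → ℕ}
    (hq : ∀ j, (q j).IsHomogeneous (d j)) : Scheme.{0} :=
  letI := quotientGradedAlgebra (homogeneousSubmodule (Fin m) k) (isHomogeneous_span hq)
  Proj (coordinateGrading q)

/-- The structure morphism of the closed subscheme cut out by `q₁, …, q_r`. -/
def zeroLocusStructure (q : Fin r → MvPolynomial (Fin m) k) {d : Fin r → ℕ}
    (hq : ∀ j, (q j).IsHomogeneous (d j)) : zeroLocus q hq ⟶ Spec (.of k) :=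
  letI := quotientGradedAlgebra (homogeneousSubmodule (Fin m) k) (isHomogeneous_span hq)
  projStructure (coordinateGrading q)

end ProjectiveSpace

/-! ### The three quadrics -/

section Curve

open MvPolynomial

/-- The three quadratic forms over `𝔽₃`; the coordinates `x₁, …, x₅` are `X 0, …, X 4`. -/
def quadric : Fin 3 → MvPolynomial (Fin 5) (ZMod 3) :=
  ![2 * X 0 * X 1 + X 2 * X 1 + X 2 ^ 2 - X 3 ^ 2,
    X 4 * X 0 - X 3 * X 1,
    X 0 ^ 2 + X 0 * X 1 - X 2 ^ 2 + X 4 ^ 2]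

lemma quadric_isHomogeneous (j : Fin 3) : (quadric j).IsHomogeneous 2 := by
  have h (a b : Fin 5) : (X a * X b : MvPolynomial (Fin 5) (ZMod 3)).IsHomogeneous 2 :=
    (isHomogeneous_X _ a).mul (isHomogeneous_X _ b)
  have h2 (a : Fin 5) : (X a ^ 2 : MvPolynomial (Fin 5) (ZMod 3)).IsHomogeneous 2 := by
    rw [pow_two]
    exact h a a
  have h0 : (2 * X 0 * X 1 : MvPolynomial (Fin 5) (ZMod 3)).IsHomogeneous 2 := by
    rw [mul_assoc, two_mul]
    exact (h 0 1).add (h 0 1)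
  fin_cases j
  · exact ((h0.add (h 2 1)).add (h2 2)).sub (h2 3)
  · exact (h 4 0).sub (h 3 1)
  · exact (((h2 0).add (h 0 1)).sub (h2 2)).add (h2 4)

/-- The curve `C ⊆ ℙ⁴` over `𝔽₃` defined by the three quadrics. -/
def C : Scheme.{0} := zeroLocus quadric quadric_isHomogeneous

/-- The structure morphism `C ⟶ Spec 𝔽₃`. -/
def CStructure : C ⟶ Spec (.of (ZMod 3)) := zeroLocusStructure quadric quadric_isHomogeneous

end Curve

end GenusFive

end

/-!
# A smooth curve of genus five over `𝔽₃` with thirteen rational points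

The coordinate `x₂` vanishes nowhere on `C` together with `x₃`, so the affine charts `x₂ = 1` and
`x₃ = 1` cover `C` (`mem_basicOpen_or`). All assertions are read off from these two charts, whose
coordinate rings are quotients of the polynomial ring by the dehomogenized quadrics
(`awayEquivChart`).

*Rational points.* A section of `C ⟶ Spec 𝔽₃` has its image in one of the charts, where it is a
solution of the equations, and the solutions are counted.

*Smoothness.* On each chart the maximal minors of the Jacobian matrix generate the unit ideal
(`one_eq_quadricMinor_one`, `one_eq_quadricMinor_two`).

*Geometric irreducibility.* On the chart `x₂ = 1` put `λ = x₁` and `μ = x₅`. Then `x₄ = λμ` and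
`x₃ = λ²μ² - λ² - μ²`, and the chart is the plane curve
`(λ² - 1)² μ⁴ + (λ² (λ² - 1) - 1) μ² + (λ⁴ - λ² - λ) = 0`, also after extension of the base field.
The equation is biquadratic in `μ`, and it is irreducible because neither its constant term nor its
discriminant is a square (`prime_planePoly`). The chart is dense since `x₂` is not a zero divisor in
the homogeneous coordinate ring (`eq_zero_of_coord_one_mul`), and it remains dense after extension
of the base field since base change along a field extension is open.

*Genus.* The homogeneous coordinate ring of `C` is free over `𝔽₃[x₂, x₃]` with basis
`1, x₁, x₄, x₅, x₁², x₁x₄, x₅x₄, x₁²x₄`. These elements generate it because their span is stable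
under multiplication by the coordinates (`aeval_mem_normalSpan`). They are independent because on
`x₂x₃ ≠ 0` the curve is a tower of two monogenic extensions, of degrees four and two, of the ring of
Laurent polynomials in `x₃ / x₂` (`towerCoord_normalBasis`). The group `H¹(C, 𝒪)` is the cokernel of
the Čech complex of the two charts. For a basis element `e` of degree `d`, the fractions
`x₂ᵘ x₃ᵛ e / (x₂x₃)ⁿ` of degree zero that extend to neither chart are the `e / x₂ᵃ x₃ᵇ` with
`a, b ≥ 1` and `a + b = d`. The basis has three elements of degree two, contributing one class each,
and one of degree three, contributing two (`exists_of_cechClass_eq_zero`).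

That `H¹`, defined by injective resolutions, is the cokernel of the Čech complex
(`nonempty_H_one_addEquiv`) rests on two facts: injective sheaves are flasque
(`surjective_restrict_of_injective`), and sections over an affine open subset lift along
epimorphisms with kernel the structure sheaf (`isAcyclicOn_of_isAffineOpen`).
-/

noncomputable section

/-! ### Affine charts of closed subschemes of projective space -/

namespace GenusFive

open MvPolynomial HomogeneousLocalization

attribute [local instance] MvPolynomial.gradedAlgebra

section Charts

variable {k : Type} [Field k] {m r : ℕ}

/-- The ideal of the affine chart `x_i = 1`: the dehomogenized equations. -/
def chartIdeal (q : Fin r → MvPolynomial (Fin m) k) (i : Fin m) : Ideal (MvPolynomial (Fin m) k) :=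
  Ideal.span (Set.range (Fin.cons (X i - 1) q : Fin (r + 1) → MvPolynomial (Fin m) k))

/-- The coordinate ring of the affine chart `x_i = 1` of the zero locus of `q`. -/
abbrev ChartRing (q : Fin r → MvPolynomial (Fin m) k) (i : Fin m) : Type :=
  MvPolynomial (Fin m) k ⧸ chartIdeal q i

variable (q : Fin r → MvPolynomial (Fin m) k) {d : Fin r → ℕ}
  (hq : ∀ j, (q j).IsHomogeneous (d j))

lemma span_le_chartIdeal (i : Fin m) : Ideal.span (Set.range q) ≤ chartIdeal q i := by
  refine Ideal.span_le.mpr ?_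
  rintro _ ⟨j, rfl⟩
  exact Ideal.subset_span ⟨j.succ, by simp⟩

lemma X_sub_one_mem_chartIdeal (i : Fin m) : X i - 1 ∈ chartIdeal q i :=
  Ideal.subset_span ⟨0, by simp⟩

lemma mk_X_self (i : Fin m) : (Ideal.Quotient.mk (chartIdeal q i)) (X i) = 1 := by
  rw [← map_one (Ideal.Quotient.mk (chartIdeal q i)), Ideal.Quotient.eq]
  exact X_sub_one_mem_chartIdeal q i

/-- The homogeneous coordinates as elements of the homogeneous coordinate ring. -/
abbrev coord (i : Fin m) : MvPolynomial (Fin m) k ⧸ Ideal.span (Set.range q) :=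
  Ideal.Quotient.mk _ (X i)

lemma mk_mem_coordinateGrading {n : ℕ} {p : MvPolynomial (Fin m) k} (hp : p.IsHomogeneous n) :
    Ideal.Quotient.mk _ p ∈ coordinateGrading q n := ⟨p, hp, rfl⟩

lemma coord_mem (i : Fin m) : coord q i ∈ coordinateGrading q 1 :=
  mk_mem_coordinateGrading q (isHomogeneous_X k i)

/-- Setting `x_i = 1` in the homogeneous coordinate ring. -/
def dehomogenize (i : Fin m) :
    (MvPolynomial (Fin m) k ⧸ Ideal.span (Set.range q)) →+* ChartRing q i :=
  Ideal.Quotient.factor (span_le_chartIdeal q i)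

@[simp] lemma dehomogenize_mk (i : Fin m) (p : MvPolynomial (Fin m) k) :
    dehomogenize q i (Ideal.Quotient.mk _ p) = Ideal.Quotient.mk _ p := rfl

variable [GradedAlgebra (coordinateGrading q)]

/-- Dehomogenization on the degree zero part of the localization at `x_i`. -/
def awayToChart (i : Fin m) : Away (coordinateGrading q) (coord q i) →+* ChartRing q i :=
  (IsLocalization.Away.lift (S := Localization.Away (coord q i)) (coord q i)
    (g := dehomogenize q i)
    (by rw [coord, dehomogenize_mk, mk_X_self]; exact isUnit_one)).comp
    (algebraMap (Away (coordinateGrading q) (coord q i)) (Localization.Away (coord q i)))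

lemma awayToChart_mk (i : Fin m) (n : ℕ) (a) (ha : a ∈ coordinateGrading q (n • 1)) :
    awayToChart q i (Away.mk _ (coord_mem q i) n a ha) = dehomogenize q i a := by
  rw [awayToChart, RingHom.comp_apply, HomogeneousLocalization.algebraMap_apply, Away.val_mk,
    Localization.mk_eq_mk', IsLocalization.Away.lift, IsLocalization.lift_mk'_spec]
  simp [mk_X_self]

lemma awayToChart_surjective (i : Fin m) : Function.Surjective (awayToChart q i) := by
  intro x
  obtain ⟨p, rfl⟩ := Ideal.Quotient.mk_surjective x
  induction p using MvPolynomial.induction_on with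
  | C a =>
    exact ⟨Away.mk _ (coord_mem q i) 0 (Ideal.Quotient.mk _ (MvPolynomial.C a))
      (mk_mem_coordinateGrading q (by simpa using isHomogeneous_C _ a)), awayToChart_mk q i _ _ _⟩
  | add p p' h h' =>
    obtain ⟨a, ha⟩ := h
    obtain ⟨b, hb⟩ := h'
    exact ⟨a + b, by rw [map_add, ha, hb, map_add]⟩
  | mul_X p j h =>
    obtain ⟨a, ha⟩ := h
    refine ⟨a * Away.mk _ (coord_mem q i) 1 (coord q j) (coord_mem q j), ?_⟩
    rw [map_mul, ha, awayToChart_mk, map_mul]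
    rfl

lemma eval₂_mul_of_isHomogeneous {σ R B : Type*} [CommSemiring R] [CommSemiring B] (g : R →+* B)
    (c : B) (v : σ → B) {n : ℕ} {p : MvPolynomial σ R} (hp : p.IsHomogeneous n) :
    eval₂ g (fun j => c * v j) p = c ^ n * eval₂ g v p := by
  classical
  rw [eval₂_eq, eval₂_eq, Finset.mul_sum]
  refine Finset.sum_congr rfl fun s hs => ?_
  have h : s.degree = n := by
    rw [Finsupp.degree_eq_weight_one]
    exact hp (mem_support_iff.mp hs)
  rw [← h, Finsupp.degree_apply, ← Finset.prod_pow_eq_pow_sum]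
  simp only [mul_pow, Finset.prod_mul_distrib]
  ring

/-- The coordinate `x_j / x_i` on the chart `x_i ≠ 0`. -/
def ratio (i j : Fin m) : Away (coordinateGrading q) (coord q i) :=
  Away.mk _ (coord_mem q i) 1 (coord q j) (coord_mem q j)

/-- The structure map of the chart ring. -/
def scalarAway (i : Fin m) : k →+* Away (coordinateGrading q) (coord q i) :=
  (fromZeroRingHom _ _).comp (algebraMap k (coordinateGrading q 0))

/-- A form of degree `n` takes the value `p / x_iⁿ` at the ratios `x_j / x_i`. -/
lemma eval₂_ratio (i : Fin m) {n : ℕ} {p : MvPolynomial (Fin m) k} (hp : p.IsHomogeneous n) :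
    eval₂ (scalarAway q i) (ratio q i) p =
      Away.mk _ (coord_mem q i) n (Ideal.Quotient.mk _ p)
        (mk_mem_coordinateGrading q (by simpa using hp)) := by
  apply val_injective
  rw [Away.val_mk]
  let φ : (MvPolynomial (Fin m) k ⧸ Ideal.span (Set.range q)) →+* Localization.Away (coord q i) :=
    algebraMap _ _
  have hv (j : Fin m) : (ratio q i j).val =
      Localization.mk 1 ⟨coord q i, Submonoid.mem_powers _⟩ * φ (coord q j) := by
    rw [ratio, Away.val_mk, ← Localization.mk_one_eq_algebraMap, Localization.mk_mul]
    congr 1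
    · simp
    · ext; simp
  have key : (eval₂ (scalarAway q i) (ratio q i) p).val =
      eval₂ ((φ.comp (algebraMap k _)))
        (fun j => Localization.mk 1 ⟨coord q i, Submonoid.mem_powers _⟩ * φ (coord q j)) p := by
    change algebraMap (Away (coordinateGrading q) (coord q i)) (Localization.Away (coord q i)) _ = _
    rw [hom_eval₂]
    congr 1
    ext j
    exact hv j
  rw [key, eval₂_mul_of_isHomogeneous _ _ _ hp]
  have : eval₂ (φ.comp (algebraMap k _)) (fun j => φ (coord q j)) p =
      φ (Ideal.Quotient.mk _ p) := by
    change _ = (φ.comp (Ideal.Quotient.mk _)) p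
    rw [← coe_eval₂Hom]
    congr 1
    refine MvPolynomial.ringHom_ext (fun a => ?_) fun j => ?_
    · rw [eval₂Hom_C]
      rfl
    · rw [eval₂Hom_X']
      rfl
  rw [this, ← Localization.mk_one_eq_algebraMap, Localization.mk_pow, Localization.mk_mul]
  congr 1
  · simp
  · ext; simp

include hq in
lemma eval₂_ratio_eq_zero (i : Fin m) {p : MvPolynomial (Fin m) k} (hp : p ∈ chartIdeal q i) :
    eval₂ (scalarAway q i) (ratio q i) p = 0 := by
  suffices chartIdeal q i ≤ RingHom.ker (eval₂Hom (scalarAway q i) (ratio q i)) from this hp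
  refine Ideal.span_le.mpr ?_
  rintro _ ⟨j, rfl⟩
  change eval₂Hom _ _ _ = 0
  refine Fin.cases ?_ (fun j => ?_) j
  · rw [Fin.cons_zero, map_sub, map_one, sub_eq_zero]
    apply val_injective
    rw [coe_eval₂Hom, eval₂_X, ratio, Away.val_mk, val_one]
    convert! Localization.mk_self _
    simp
  · rw [Fin.cons_succ, coe_eval₂Hom, eval₂_ratio q i (hq j)]
    apply val_injective
    rw [Away.val_mk, val_zero, (Ideal.Quotient.eq_zero_iff_mem (I := Ideal.span (Set.range q))).mpr
      (Ideal.subset_span (Set.mem_range_self j)),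
      Localization.mk_zero]

include hq in
/-- A fraction `p / x_iⁿ` is the value of `p` at the ratios `x_j / x_i`, and these satisfy the
equations of the chart. -/
lemma awayToChart_injective (i : Fin m) : Function.Injective (awayToChart q i) := by
  rw [injective_iff_map_eq_zero]
  intro x hx
  obtain ⟨n, a, ha, rfl⟩ := Away.mk_surjective _ (coord_mem q i) x
  obtain ⟨p, hp, rfl⟩ := id ha
  have hp' : p.IsHomogeneous n := by simpa using hp
  rw [awayToChart_mk] at hx
  rw [← eval₂_ratio_eq_zero q hq i (Ideal.Quotient.eq_zero_iff_mem.mp hx)]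
  exact (eval₂_ratio q i hp').symm

lemma awayToChart_scalar (i : Fin m) (c : k) :
    awayToChart q i (scalarAway q i c) = algebraMap k (ChartRing q i) c := by
  have : scalarAway q i c = eval₂ (scalarAway q i) (ratio q i) (MvPolynomial.C c) := by rw [eval₂_C]
  rw [this, eval₂_ratio q i (isHomogeneous_C _ c), awayToChart_mk]
  rfl

lemma awayToChart_ratio (i j : Fin m) :
    awayToChart q i (ratio q i j) = Ideal.Quotient.mk _ (X j) :=
  awayToChart_mk q i _ _ _

/-- The degree zero part of the localization at `x_i` is the coordinate ring of the chart
`x_i = 1`. -/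
def awayEquivChart (i : Fin m) :
    Away (coordinateGrading q) (coord q i) ≃+* ChartRing q i :=
  RingEquiv.ofBijective (awayToChart q i)
    ⟨awayToChart_injective q hq i, awayToChart_surjective q i⟩

end Charts
end GenusFive

/-! ### Chart morphisms, properness and rational points -/

namespace GenusFive

open MvPolynomial HomogeneousLocalization

attribute [local instance] MvPolynomial.gradedAlgebra

section ChartMap

variable {k : Type} [Field k] {m r : ℕ}
  (q : Fin r → MvPolynomial (Fin m) k) {d : Fin r → ℕ}
  (hq : ∀ j, (q j).IsHomogeneous (d j)) [GradedAlgebra (coordinateGrading q)]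

/-- The affine chart `x_i = 1` of the closed subscheme cut out by `q`. -/
def chartMap (i : Fin m) : Spec (.of (ChartRing q i)) ⟶ Proj (coordinateGrading q) :=
  Spec.map (CommRingCat.ofHom (awayToChart q i)) ≫
    Proj.awayι (coordinateGrading q) (coord q i) (coord_mem q i) one_pos

include hq in
lemma isIso_Spec_awayToChart (i : Fin m) :
    IsIso (Spec.map (CommRingCat.ofHom (awayToChart q i))) :=
  have : IsIso (CommRingCat.ofHom (awayToChart q i)) :=
    (awayEquivChart q hq i).toCommRingCatIso.isIso_hom
  inferInstance

include hq in
lemma isOpenImmersion_chartMap (i : Fin m) : IsOpenImmersion (chartMap q i) :=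
  have := isIso_Spec_awayToChart q hq i
  IsOpenImmersion.comp _ _

include hq in
lemma range_chartMap (i : Fin m) :
    Set.range (chartMap q i) = Proj.basicOpen (coordinateGrading q) (coord q i) := by
  have := isIso_Spec_awayToChart q hq i
  have h := congr($(Proj.opensRange_awayι (coordinateGrading q) (coord q i) (coord_mem q i)
    one_pos).1)
  refine Eq.trans ?_ h
  exact congr($(Scheme.Hom.opensRange_comp_of_isIso (Spec.map (CommRingCat.ofHom
    (awayToChart q i))) (Proj.awayι (coordinateGrading q) (coord q i) (coord_mem q i) one_pos)).1)

lemma chartMap_structure (i : Fin m) :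
    chartMap q i ≫ projStructure (coordinateGrading q) =
      Spec.map (CommRingCat.ofHom (algebraMap k (ChartRing q i))) := by
  rw [chartMap, projStructure, Category.assoc, Proj.awayι_toSpecZero_assoc, ← Spec.map_comp,
    ← Spec.map_comp]
  congr 1
  ext c
  exact awayToChart_scalar q i c

lemma chartMap_mem_basicOpen (i j : Fin m) (x : Spec (.of (ChartRing q i))) :
    chartMap q i x ∈ Proj.basicOpen (coordinateGrading q) (coord q j) ↔
      Ideal.Quotient.mk (chartIdeal q i) (X j) ∉ x.asIdeal := by
  have h := Proj.awayι_preimage_basicOpen (coordinateGrading q) (coord_mem q i) one_pos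
    (coord_mem q j) one_pos
  have h2 : chartMap q i x ∈ Proj.basicOpen (coordinateGrading q) (coord q j) ↔
      Spec.map (CommRingCat.ofHom (awayToChart q i)) x ∈
        (Proj.awayι (coordinateGrading q) (coord q i) (coord_mem q i) one_pos) ⁻¹ᵁ
          Proj.basicOpen (coordinateGrading q) (coord q j) := by
    rw [chartMap]
    rfl
  rw [h2, h]
  refine not_iff_not.mpr ?_
  change awayToChart q i _ ∈ x.asIdeal ↔ _
  rw [← awayToChart_ratio]
  congr! 3
  apply val_injective
  simp [Away.isLocalizationElem, ratio, Away.val_mk]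

omit [GradedAlgebra (coordinateGrading q)] in
lemma adjoin_coord : Algebra.adjoin k (Set.range (coord q)) = ⊤ := by
  have h : (Ideal.Quotient.mkₐ k (Ideal.span (Set.range q))).range = ⊤ :=
    (AlgHom.range_eq_top _).mpr (Ideal.Quotient.mkₐ_surjective _ _)
  rw [← h, ← Algebra.map_top, ← MvPolynomial.adjoin_range_X, AlgHom.map_adjoin, ← Set.range_comp]
  rfl

instance : IsScalarTower k (coordinateGrading q 0)
    (MvPolynomial (Fin m) k ⧸ Ideal.span (Set.range q)) :=
  ⟨fun a b c => smul_mul_assoc a (b : MvPolynomial (Fin m) k ⧸ Ideal.span (Set.range q)) c⟩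

lemma exists_mem_basicOpen (x : Proj (coordinateGrading q)) :
    ∃ i, x ∈ Proj.basicOpen (coordinateGrading q) (coord q i) := by
  have h := Proj.iSup_basicOpen_eq_top' (coordinateGrading q) (coord q)
    (fun i => ⟨1, coord_mem q i⟩) (by
      rw [← top_le_iff]
      intro a _
      have ha : a ∈ Algebra.adjoin k (Set.range (coord q)) := by rw [adjoin_coord]; trivial
      have : Algebra.adjoin k (Set.range (coord q)) ≤
          (Algebra.adjoin (coordinateGrading q 0) (Set.range (coord q))).restrictScalars k :=
        Algebra.adjoin_le Algebra.subset_adjoin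
      exact this ha)
  exact TopologicalSpace.Opens.mem_iSup.mp (h.ge (Set.mem_univ x))

omit [GradedAlgebra (coordinateGrading q)] in
lemma scalar_zero_surjective : Function.Surjective (algebraMap k (coordinateGrading q 0)) := by
  rintro ⟨_, p, hp, rfl⟩
  refine ⟨coeff 0 p, Subtype.ext ?_⟩
  have : p = MvPolynomial.C (coeff 0 p) :=
    totalDegree_eq_zero_iff_eq_C.mp (Nat.le_zero.mp (IsHomogeneous.totalDegree_le hp))
  change algebraMap k (_ ⧸ _) _ = Ideal.Quotient.mk _ p
  conv_rhs => rw [this]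
  rfl

/-- `Proj` of a finitely generated algebra is proper over its degree zero part, which is a quotient
of `k`. -/
lemma isProper_projStructure : IsProper (projStructure (coordinateGrading q)) := by
  have h1 : IsClosedImmersion
      (Spec.map (CommRingCat.ofHom (algebraMap k (coordinateGrading q 0)))) :=
    IsClosedImmersion.spec_of_surjective _ (scalar_zero_surjective q)
  have h2 : Algebra.FiniteType k (MvPolynomial (Fin m) k ⧸ Ideal.span (Set.range q)) :=
    inferInstance
  have h3 : Algebra.FiniteType (coordinateGrading q 0)
      (MvPolynomial (Fin m) k ⧸ Ideal.span (Set.range q)) :=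
    Algebra.FiniteType.of_restrictScalars_finiteType k _ _
  rw [projStructure]
  infer_instance

end ChartMap

section RationalPoints

variable {k : Type} [Field k] {m r : ℕ}
  (q : Fin r → MvPolynomial (Fin m) k) {d : Fin r → ℕ}
  (hq : ∀ j, (q j).IsHomogeneous (d j)) [GradedAlgebra (coordinateGrading q)]

/-- A solution of `q` with `x_i = 1`, as a point of the chart ring. -/
def chartEval (i : Fin m) (v : {v : Fin m → k // v i = 1 ∧ ∀ j, eval v (q j) = 0}) :
    ChartRing q i →ₐ[k] k :=
  Ideal.Quotient.liftₐ _ (aeval v.1) (by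
    suffices chartIdeal q i ≤ RingHom.ker (aeval (R := k) v.1) from fun a ha => this ha
    refine Ideal.span_le.mpr ?_
    rintro _ ⟨j, rfl⟩
    change aeval _ _ = 0
    refine Fin.cases ?_ (fun j => ?_) j
    · simp [v.2.1]
    · simpa using v.2.2 j)

/-- The points of the chart `x_i = 1` over `k` are the solutions of the equations. -/
def chartEvalEquiv (i : Fin m) :
    {v : Fin m → k // v i = 1 ∧ ∀ j, eval v (q j) = 0} ≃ (ChartRing q i →ₐ[k] k) where
  toFun := chartEval q i
  invFun φ := ⟨fun j => φ (Ideal.Quotient.mk _ (X j)),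
    (congrArg φ (mk_X_self q i)).trans (map_one φ), fun j => by
    have h (p) : eval (fun j => φ (Ideal.Quotient.mk _ (X j))) p =
        φ (Ideal.Quotient.mk (chartIdeal q i) p) := by
      rw [← coe_aeval_eq_eval]
      change _ = (φ.comp (Ideal.Quotient.mkₐ k (chartIdeal q i))) p
      conv_rhs => rw [aeval_unique (φ.comp (Ideal.Quotient.mkₐ k (chartIdeal q i)))]
      rfl
    rw [h, Ideal.Quotient.eq_zero_iff_mem.mpr
      (span_le_chartIdeal q i (Ideal.subset_span (Set.mem_range_self j))), map_zero]⟩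
  left_inv v := by
    ext j
    change aeval v.1 (X j) = _
    simp
  right_inv φ := by
    apply AlgHom.coe_ringHom_injective
    apply Ideal.Quotient.ringHom_ext
    refine MvPolynomial.ringHom_ext (fun a => ?_) fun j => ?_
    · change aeval _ (MvPolynomial.C a) = φ (algebraMap k _ a)
      rw [φ.commutes, aeval_C]
    · change aeval _ (X j) = _
      rw [aeval_X]
      rfl

/-- The rational point given by a `k`-valued point of the chart `x_i = 1`. -/
def pointOfEval (i : Fin m) (φ : ChartRing q i →ₐ[k] k) :
    RationalPoint (projStructure (coordinateGrading q)) :=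
  ⟨Spec.map (CommRingCat.ofHom φ.toRingHom) ≫ chartMap q i, by
    rw [Category.assoc, chartMap_structure, ← Spec.map_comp, ← CommRingCat.ofHom_comp,
      ← Spec.map_id]
    congr 2
    exact φ.comp_algebraMap⟩

/-- The unique point of the spectrum of a field. -/
abbrev thePoint (k : Type) [Field k] : Spec (.of k) := (⊥ : PrimeSpectrum k)

include hq in
lemma pointOfEval_injective (i : Fin m) : Function.Injective (pointOfEval q i) := by
  intro φ ψ h
  have := isOpenImmersion_chartMap q hq i
  have h' := (cancel_mono (chartMap q i)).mp congr($(h).1)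
  have h'' := Spec.map_injective h'
  apply AlgHom.coe_ringHom_injective
  exact congr($(h'').hom)

include hq in
lemma exists_pointOfEval (i : Fin m) (s : RationalPoint (projStructure (coordinateGrading q)))
    (hs : s.1 (thePoint k) ∈ Proj.basicOpen (coordinateGrading q) (coord q i)) :
    ∃ φ, pointOfEval q i φ = s := by
  have := isOpenImmersion_chartMap q hq i
  have hr : Set.range s.1 ⊆ Set.range (chartMap q i) := by
    rintro _ ⟨y, rfl⟩
    rw [range_chartMap q hq]
    rwa [show y = thePoint k from Subsingleton.elim (α := PrimeSpectrum k) _ _]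
  let g := IsOpenImmersion.lift (chartMap q i) s.1 hr
  have hg : g ≫ chartMap q i = s.1 := IsOpenImmersion.lift_fac _ _ _
  obtain ⟨φ, hφ⟩ := Spec.map_surjective g
  have h1 : Spec.map (CommRingCat.ofHom (algebraMap k (ChartRing q i)) ≫ φ) =
      Spec.map (𝟙 (CommRingCat.of k)) := by
    rw [Spec.map_comp, hφ, ← chartMap_structure, ← Category.assoc, hg, s.2, Spec.map_id]
  have h2 := Spec.map_injective h1
  refine ⟨⟨φ.hom, fun c => congr($(h2).hom c)⟩, Subtype.ext ?_⟩
  rw [← hg, ← hφ]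
  rfl

lemma pointOfEval_mem_basicOpen (i j : Fin m) (φ : ChartRing q i →ₐ[k] k) :
    (pointOfEval q i φ).1 (thePoint k) ∈ Proj.basicOpen (coordinateGrading q) (coord q j) ↔
      φ (Ideal.Quotient.mk _ (X j)) ≠ 0 := by
  have : (pointOfEval q i φ).1 (thePoint k) =
      chartMap q i (Spec.map (CommRingCat.ofHom φ.toRingHom) (thePoint k)) := by
    rw [pointOfEval]
    rfl
  rw [this, chartMap_mem_basicOpen]
  exact not_iff_not.mpr Iff.rfl

include hq in
/-- If `D₊(x_i)` and `D₊(x_j)` cover the scheme, its rational points are the solutions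
with `x_i = 1`, together with those with `x_j = 1` and `x_i = 0`. -/
lemma card_rationalPoint (i j : Fin m) [Finite k]
    (hij : ∀ x, x ∈ Proj.basicOpen (coordinateGrading q) (coord q i) ∨
      x ∈ Proj.basicOpen (coordinateGrading q) (coord q j)) :
    Nat.card (RationalPoint (projStructure (coordinateGrading q))) =
      Nat.card {v : Fin m → k // v i = 1 ∧ ∀ l, eval v (q l) = 0} +
      Nat.card {v : Fin m → k // (v j = 1 ∧ ∀ l, eval v (q l) = 0) ∧ v i = 0} := by
  let f : {v : Fin m → k // v i = 1 ∧ ∀ l, eval v (q l) = 0} ⊕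
      {v : {v : Fin m → k // v j = 1 ∧ ∀ l, eval v (q l) = 0} // v.1 i = 0} →
      RationalPoint (projStructure (coordinateGrading q)) :=
    Sum.elim (fun v => pointOfEval q i (chartEvalEquiv q i v))
      (fun v => pointOfEval q j (chartEvalEquiv q j v.1))
  have hl (v) : (f (Sum.inl v)).1 (thePoint k) ∈
      Proj.basicOpen (coordinateGrading q) (coord q i) := by
    refine (pointOfEval_mem_basicOpen q i i _).mpr ?_
    rw [mk_X_self, map_one]
    exact one_ne_zero
  have hr (v : {v : {v : Fin m → k // v j = 1 ∧ ∀ l, eval v (q l) = 0} // v.1 i = 0}) :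
      (f (Sum.inr v)).1 (thePoint k) ∉ Proj.basicOpen (coordinateGrading q) (coord q i) := by
    refine fun h => (pointOfEval_mem_basicOpen q j i _).mp h ?_
    change aeval v.1.1 (X i) = 0
    rw [aeval_X, v.2]
  have hf : Function.Bijective f := by
    refine ⟨?_, fun s => ?_⟩
    · rintro (v | v) (w | w) h
      · exact congrArg _ ((chartEvalEquiv q i).injective (pointOfEval_injective q hq i h))
      · exact (hr w (h ▸ hl v)).elim
      · exact (hr v (h ▸ hl w)).elim
      · exact congrArg _ (Subtype.ext
          ((chartEvalEquiv q j).injective (pointOfEval_injective q hq j h)))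
    · by_cases hs : s.1 (thePoint k) ∈ Proj.basicOpen (coordinateGrading q) (coord q i)
      · obtain ⟨φ, rfl⟩ := exists_pointOfEval q hq i s hs
        obtain ⟨v, rfl⟩ := (chartEvalEquiv q i).surjective φ
        exact ⟨Sum.inl v, rfl⟩
      · obtain ⟨φ, rfl⟩ := exists_pointOfEval q hq j s ((hij _).resolve_left hs)
        obtain ⟨v, rfl⟩ := (chartEvalEquiv q j).surjective φ
        refine ⟨Sum.inr ⟨v, ?_⟩, rfl⟩
        rw [pointOfEval_mem_basicOpen, not_not] at hs
        change aeval v.1 (X i) = 0 at hs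
        rwa [aeval_X] at hs
  rw [← Nat.card_eq_of_bijective f hf, Nat.card_sum]
  congr 1
  exact Nat.card_congr (Equiv.subtypeSubtypeEquivSubtypeInter
    (fun v : Fin m → k => v j = 1 ∧ ∀ l, eval v (q l) = 0) (fun v => v i = 0))

end RationalPoints

end GenusFive

/-! ### The two charts of the curve and its rational points -/

namespace GenusFive

open MvPolynomial HomogeneousLocalization

attribute [local instance] MvPolynomial.gradedAlgebra

section Cover

/-- The grading of the homogeneous coordinate ring of `C`. -/
instance : GradedAlgebra (coordinateGrading quadric) :=
  quotientGradedAlgebra (homogeneousSubmodule (Fin 5) (ZMod 3))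
    (isHomogeneous_span quadric_isHomogeneous)

lemma mk_quadric (l : Fin 3) :
    Ideal.Quotient.mk (Ideal.span (Set.range quadric)) (quadric l) = 0 :=
  Ideal.Quotient.eq_zero_iff_mem.mpr (Ideal.subset_span (Set.mem_range_self l))

lemma quadric_zero : quadric 0 = 2 * X 0 * X 1 + X 2 * X 1 + X 2 ^ 2 - X 3 ^ 2 := rfl

lemma quadric_one : quadric 1 = X 4 * X 0 - X 3 * X 1 := rfl

lemma quadric_two : quadric 2 = X 0 ^ 2 + X 0 * X 1 - X 2 ^ 2 + X 4 ^ 2 := rfl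

lemma coord_quadric_zero : 2 * coord quadric 0 * coord quadric 1 + coord quadric 2 * coord quadric 1
    + coord quadric 2 ^ 2 - coord quadric 3 ^ 2 = 0 := by
  have h := mk_quadric 0
  rw [quadric_zero] at h
  simpa only [map_sub, map_add, map_mul, map_pow, map_ofNat] using h

lemma coord_quadric_one :
    coord quadric 4 * coord quadric 0 - coord quadric 3 * coord quadric 1 = 0 := by
  have h := mk_quadric 1
  rw [quadric_one] at h
  simpa only [map_sub, map_add, map_mul, map_pow, map_ofNat] using h

lemma coord_quadric_two : coord quadric 0 ^ 2 + coord quadric 0 * coord quadric 1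
    - coord quadric 2 ^ 2 + coord quadric 4 ^ 2 = 0 := by
  have h := mk_quadric 2
  rw [quadric_two] at h
  simpa only [map_sub, map_add, map_mul, map_pow, map_ofNat] using h

/-- No point of `C` satisfies `x₂ = x₃ = 0`. -/
lemma mem_basicOpen_or (x : Proj (coordinateGrading quadric)) :
    x ∈ Proj.basicOpen (coordinateGrading quadric) (coord quadric 1) ∨
      x ∈ Proj.basicOpen (coordinateGrading quadric) (coord quadric 2) := by
  by_contra! h
  obtain ⟨h1, h2⟩ := h
  rw [Proj.mem_basicOpen, not_not] at h1 h2
  set P := x.asHomogeneousIdeal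
  have hP : P.toIdeal.IsPrime := x.isPrime
  change coord quadric 1 ∈ P.toIdeal at h1
  change coord quadric 2 ∈ P.toIdeal at h2
  have h3 : coord quadric 3 ∈ P.toIdeal := by
    refine hP.mem_of_pow_mem 2 ?_
    have : coord quadric 3 ^ 2 = (2 * coord quadric 0 + coord quadric 2) * coord quadric 1 +
        coord quadric 2 * coord quadric 2 := by linear_combination - coord_quadric_zero
    rw [this]
    exact add_mem (Ideal.mul_mem_left _ _ h1) (Ideal.mul_mem_left _ _ h2)
  have h40 : coord quadric 4 * coord quadric 0 ∈ P.toIdeal := by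
    have : coord quadric 4 * coord quadric 0 = coord quadric 3 * coord quadric 1 := by
      linear_combination coord_quadric_one
    rw [this]
    exact Ideal.mul_mem_left _ _ h1
  have hs : coord quadric 0 ^ 2 + coord quadric 4 ^ 2 ∈ P.toIdeal := by
    have : coord quadric 0 ^ 2 + coord quadric 4 ^ 2 =
        coord quadric 2 * coord quadric 2 - coord quadric 0 * coord quadric 1 := by
      linear_combination coord_quadric_two
    rw [this]
    exact sub_mem (Ideal.mul_mem_left _ _ h2) (Ideal.mul_mem_left _ _ h1)
  have h04 : coord quadric 0 ∈ P.toIdeal ∧ coord quadric 4 ∈ P.toIdeal := by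
    rcases hP.mem_or_mem h40 with h | h
    · refine ⟨hP.mem_of_pow_mem 2 ?_, h⟩
      simpa using sub_mem hs (Ideal.pow_mem_of_mem _ h 2 two_pos)
    · refine ⟨h, hP.mem_of_pow_mem 2 ?_⟩
      simpa using sub_mem hs (Ideal.pow_mem_of_mem _ h 2 two_pos)
  obtain ⟨i, hi⟩ := exists_mem_basicOpen quadric x
  rw [Proj.mem_basicOpen] at hi
  apply hi
  change coord quadric i ∈ P.toIdeal
  fin_cases i
  exacts [h04.1, h1, h2, h3, h04.2]

end Cover

section Count

lemma eval_quadric_eq_zero_iff (v : Fin 5 → ZMod 3) : (∀ l, eval v (quadric l) = 0) ↔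
    2 * v 0 * v 1 + v 2 * v 1 + v 2 ^ 2 - v 3 ^ 2 = 0 ∧ v 4 * v 0 - v 3 * v 1 = 0 ∧
      v 0 ^ 2 + v 0 * v 1 - v 2 ^ 2 + v 4 ^ 2 = 0 := by
  simp [Fin.forall_fin_succ, quadric]

theorem card_rationalPoint_quadric :
    Nat.card (RationalPoint (projStructure (coordinateGrading quadric))) = 13 := by
  rw [card_rationalPoint quadric quadric_isHomogeneous 1 2 mem_basicOpen_or]
  simp only [eval_quadric_eq_zero_iff]
  rw [Nat.card_eq_fintype_card, Nat.card_eq_fintype_card]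
  decide +kernel

end Count

end GenusFive

/-! ### Irreducibility of the plane model -/

namespace PlaneModel

section Biquadratic

open Polynomial

/-- A biquadratic polynomial is irreducible if neither its constant term nor its discriminant is a
square. In a factorization into quadratic factors with linear terms `p X` and `-p X`, either `p = 0`
and the discriminant is a square, or the constant terms agree. -/
lemma irreducible_biquadratic {E : Type*} [Field E] (b c : E) (hc : ¬ IsSquare c)
    (hd : ¬ IsSquare (b ^ 2 - 4 * c)) :
    Irreducible (X ^ 4 + C b * X ^ 2 + C c : E[X]) := by
  have hdeg : (X ^ 4 + C b * X ^ 2 + C c : E[X]).natDegree = 4 := by compute_degree!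
  have hmon : (X ^ 4 + C b * X ^ 2 + C c : E[X]).Monic := by monicity!
  rw [hmon.irreducible_iff_natDegree']
  refine ⟨fun h => by simp [h] at hdeg, ?_⟩
  intro f g hf hg hfg hmem
  have hfgd : f.natDegree + g.natDegree = 4 := by
    rw [← hf.natDegree_mul hg, hfg, hdeg]
  rw [hdeg, Finset.mem_Ioc] at hmem
  obtain ⟨hg0, hg2⟩ := hmem
  -- a root `r` would give `(2 r ^ 2 + b) ^ 2 = b ^ 2 - 4 c`
  have hroot (r : E) : r ^ 4 + b * r ^ 2 + c ≠ 0 := by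
    intro h
    exact hd ⟨2 * r ^ 2 + b, by linear_combination (-4) * h⟩
  interval_cases hgd : g.natDegree
  · have hgX : g = X + C (g.coeff 0) := by
      conv_lhs => rw [hg.as_sum, hgd]
      simp
    generalize g.coeff 0 = q at hgX
    have := congrArg (Polynomial.eval (-q)) hfg
    rw [eval_mul, hgX] at this
    simp only [eval_add, eval_X, eval_C, neg_add_cancel, mul_zero, eval_pow, eval_mul] at this
    exact hroot _ this.symm
  · have hf2 : f.natDegree = 2 := by omega
    have hgX : g = X ^ 2 + C (g.coeff 1) * X + C (g.coeff 0) := by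
      conv_lhs => rw [hg.as_sum, hgd]
      simp [Finset.sum_range_succ]
      ring
    have hfX : f = X ^ 2 + C (f.coeff 1) * X + C (f.coeff 0) := by
      conv_lhs => rw [hf.as_sum, hf2]
      simp [Finset.sum_range_succ]
      ring
    generalize g.coeff 1 = p at hgX
    generalize g.coeff 0 = q at hgX
    generalize f.coeff 1 = p' at hfX
    generalize f.coeff 0 = q' at hfX
    rw [hgX, hfX] at hfg
    have expand : (X ^ 2 + C p' * X + C q') * (X ^ 2 + C p * X + C q) =
        X ^ 4 + C (p + p') * X ^ 3 + C (q + q' + p * p') * X ^ 2 + C (p * q' + p' * q) * X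
          + C (q * q') := by
      simp only [C_add, C_mul]
      ring
    rw [expand] at hfg
    have h3 := congrArg (fun P => coeff P 3) hfg
    have h2' := congrArg (fun P => coeff P 2) hfg
    have h1 := congrArg (fun P => coeff P 1) hfg
    have h0 := congrArg (fun P => coeff P 0) hfg
    simp only [coeff_add, coeff_C_mul, coeff_X_pow, coeff_X, coeff_C] at h3 h2' h1 h0
    norm_num at h3 h2' h1 h0
    have hp' : p' = -p := by linear_combination h3
    subst hp'
    have : p * (q' - q) = 0 := by linear_combination h1
    rcases mul_eq_zero.mp this with rfl | h
    · exact hd ⟨q - q', by rw [← h2', ← h0]; ring⟩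
    · exact hc ⟨q, by rw [← h0, sub_eq_zero.mp h]⟩

end Biquadratic

section Squares

open Polynomial

variable (K : Type) [Field K] [CharP K 3]

lemma three_eq_zero : (3 : K) = 0 := by exact_mod_cast CharP.cast_eq_zero K 3

omit [CharP K 3] in
/-- The polynomial is divisible by `X` exactly once. -/
lemma not_isSquare_const : ¬ IsSquare (X ^ 4 - X ^ 2 - X : K[X]) := by
  rintro ⟨t, ht⟩
  have h0 : t.eval 0 = 0 := by
    have := congrArg (Polynomial.eval 0) ht
    simpa using this.symm
  obtain ⟨s, rfl⟩ : X ∣ t := by rwa [X_dvd_iff, coeff_zero_eq_eval_zero]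
  have h1 : X * (X ^ 3 - X - 1 : K[X]) = X * (X * s * s) := by linear_combination ht
  have h2 := congrArg (Polynomial.eval 0) (mul_left_cancel₀ X_ne_zero h1)
  simp at h2

/-- The leading coefficients determine a square root of the form `a (X³ - X² - X + 1)`, whose square
has a different coefficient at `X²`. -/
lemma not_isSquare_discr : ¬ IsSquare (X ^ 6 + X ^ 5 - X ^ 4 + X ^ 3 + X + 1 : K[X]) := by
  have h3 := three_eq_zero K
  rintro ⟨t, ht⟩
  have hd : (X ^ 6 + X ^ 5 - X ^ 4 + X ^ 3 + X + 1 : K[X]).natDegree = 6 := by compute_degree!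
  have htd : t.natDegree = 3 := by
    rw [ht, ← pow_two, natDegree_pow] at hd
    omega
  have hs : t = C (t.coeff 3) * X ^ 3 + C (t.coeff 2) * X ^ 2 + C (t.coeff 1) * X
      + C (t.coeff 0) := by
    conv_lhs => rw [t.as_sum_range_C_mul_X_pow, htd]
    simp [Finset.sum_range_succ]
    ring
  generalize t.coeff 3 = a at hs
  generalize t.coeff 2 = b at hs
  generalize t.coeff 1 = c at hs
  generalize t.coeff 0 = e at hs
  have expand : t * t = C (a * a) * X ^ 6 + C (2 * a * b) * X ^ 5 + C (b * b + 2 * a * c) * X ^ 4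
      + C (2 * a * e + 2 * b * c) * X ^ 3 + C (2 * b * e + c * c) * X ^ 2 + C (2 * c * e) * X
      + C (e * e) := by
    rw [hs]
    simp only [C_add, C_mul, C_ofNat]
    ring
  rw [expand] at ht
  have h6 := congrArg (fun P => coeff P 6) ht
  have h5 := congrArg (fun P => coeff P 5) ht
  have h4 := congrArg (fun P => coeff P 4) ht
  have h3' := congrArg (fun P => coeff P 3) ht
  have h2 := congrArg (fun P => coeff P 2) ht
  simp only [coeff_add, coeff_sub, coeff_C_mul, coeff_X_pow, coeff_X, coeff_one, coeff_C]
    at h6 h5 h4 h3' h2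
  norm_num at h6 h5 h4 h3' h2
  have hb : b = -a := by linear_combination a * h5 - 2 * b * h6 + b * h3
  subst hb
  have hc : c = -a := by linear_combination a * h4 - (2 * c + a) * h6 + (c + a) * h3
  subst hc
  have he : e = a := by linear_combination a * h3' - 2 * (e + a) * h6 + e * h3
  subst he
  have : (1 : K) = 0 := by linear_combination h6 + h2
  exact one_ne_zero this

/-- The polynomial `z² - λ - λ² - μ²` with `z = λ²μ² - λ² - μ²`, over a field of characteristic
three and as a polynomial in `μ` over `K[λ]`. It is the third quadric at `x₂ = 1`, in terms of
`λ = x₁` and `μ = x₅`, the other two quadrics giving `x₄ = λμ` and `x₃ = z`. -/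
def planePoly : K[X][X] :=
  C ((X ^ 2 - 1) ^ 2) * X ^ 4 + C (X ^ 2 * (X ^ 2 - 1) - 1) * X ^ 2 + C (X ^ 4 - X ^ 2 - X)

omit [CharP K 3] in
/-- The coefficients at `μ⁴` and `μ²` generate the unit ideal. -/
lemma isPrimitive_planePoly : (planePoly K).IsPrimitive := by
  intro r hr
  rw [C_dvd_iff_dvd_coeff] at hr
  have h4 := hr 4
  have h2 := hr 2
  simp only [planePoly, coeff_add, coeff_C_mul, coeff_X_pow, coeff_C] at h4 h2
  norm_num at h4 h2
  refine isUnit_of_dvd_one ?_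
  have : (1 : K[X]) = X ^ 4 * (X ^ 2 - 1) ^ 2 -
      (X ^ 2 * (X ^ 2 - 1) - 1) * (X ^ 2 * (X ^ 2 - 1) + 1) := by ring
  rw [this]
  exact dvd_sub (Dvd.dvd.mul_left h4 _) (Dvd.dvd.mul_right h2 _)

lemma isSquare_of_isSquare_algebraMap {R E : Type*} [CommRing R] [IsDomain R]
    [IsIntegrallyClosed R] [Field E] [Algebra R E] [IsFractionRing R E] {x : R}
    (h : IsSquare (algebraMap R E x)) : IsSquare x := by
  obtain ⟨y, hy⟩ := h
  obtain ⟨z, rfl⟩ := IsIntegrallyClosed.exists_algebraMap_eq_of_isIntegral_pow (R := R) (K := E)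
    (x := y) two_pos (by rw [pow_two, ← hy]; exact isIntegral_algebraMap)
  exact ⟨z, IsFractionRing.injective R E (by rw [hy, map_mul])⟩

/-- By Gauss's lemma it is enough to prove irreducibility over `K(λ)`. There the polynomial is
biquadratic, and up to squares its constant term is `λ⁴ - λ² - λ` and its discriminant is
`λ⁶ + λ⁵ - λ⁴ + λ³ + λ + 1`. -/
lemma prime_planePoly : Prime (planePoly K) := by
  rw [← irreducible_iff_prime,
    (isPrimitive_planePoly K).irreducible_iff_irreducible_map_fraction_map
      (K := FractionRing K[X])]
  let φ : K[X] →+* FractionRing K[X] := algebraMap _ _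
  have hφ : Function.Injective φ := IsFractionRing.injective _ _
  have hs : φ (X ^ 2 - 1) ≠ 0 := by
    rw [map_ne_zero_iff φ hφ]
    exact (monic_X_pow_sub_C (1 : K) two_ne_zero).ne_zero
  set s := φ (X ^ 2 - 1) with hs'
  set b := φ (X ^ 2 * (X ^ 2 - 1) - 1)
  set c := φ (X ^ 4 - X ^ 2 - X)
  have hmap : (planePoly K).map φ =
      C (s ^ 2) * (X ^ 4 + C (b / s ^ 2) * X ^ 2 + C (c / s ^ 2)) := by
    have h1 : C (s ^ 2) * C (b / s ^ 2) = C b := by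
      rw [← C_mul, mul_div_cancel₀ _ (pow_ne_zero 2 hs)]
    have h2 : C (s ^ 2) * C (c / s ^ 2) = C c := by
      rw [← C_mul, mul_div_cancel₀ _ (pow_ne_zero 2 hs)]
    rw [mul_add, mul_add, h2, ← mul_assoc, h1]
    simp only [planePoly, Polynomial.map_add, Polynomial.map_mul, Polynomial.map_pow, map_X, map_C,
      map_pow]
    rfl
  rw [hmap, irreducible_isUnit_mul ((isUnit_iff_ne_zero.mpr (pow_ne_zero 2 hs)).map C)]
  apply irreducible_biquadratic
  · intro h
    refine not_isSquare_const K (isSquare_of_isSquare_algebraMap (E := FractionRing K[X]) ?_)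
    have : c = c / s ^ 2 * s ^ 2 := (div_mul_cancel₀ _ (pow_ne_zero 2 hs)).symm
    change IsSquare c
    rw [this]
    exact h.mul (IsSquare.sq s)
  · intro h
    refine not_isSquare_discr K (isSquare_of_isSquare_algebraMap (E := FractionRing K[X]) ?_)
    have h3 : (3 : K[X]) = 0 := by
      rw [← C_ofNat, three_eq_zero, C_0]
    have : (X ^ 6 + X ^ 5 - X ^ 4 + X ^ 3 + X + 1 : K[X]) =
        (X ^ 2 * (X ^ 2 - 1) - 1) ^ 2 - 4 * (X ^ 4 - X ^ 2 - X) * (X ^ 2 - 1) ^ 2 := by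
      linear_combination
        (- X - 2 * X ^ 2 + 3 * X ^ 3 + 4 * X ^ 4 - X ^ 5 - 3 * X ^ 6 + X ^ 8 : K[X]) * h3
    rw [this]
    have h' : φ ((X ^ 2 * (X ^ 2 - 1) - 1) ^ 2 - 4 * (X ^ 4 - X ^ 2 - X) * (X ^ 2 - 1) ^ 2) =
        ((b / s ^ 2) ^ 2 - 4 * (c / s ^ 2)) * (s ^ 2) ^ 2 := by
      simp only [map_sub, map_mul, map_pow, map_ofNat, map_one, b, c, s]
      simp only [map_sub, map_pow, map_one, s] at hs
      field_simp
    change IsSquare (φ _)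
    rw [h']
    exact h.mul (IsSquare.sq _)

/-- The coordinate ring of the plane curve `planePoly = 0`. It is a definition of its own, and not
an abbreviation, so that it carries no algebra structures but those below. -/
def PlaneRing (K : Type) [Field K] : Type := K[X][X] ⧸ Ideal.span {planePoly K}

instance (K : Type) [Field K] : CommRing (PlaneRing K) := Ideal.Quotient.commRing _

/-- The quotient map onto the coordinate ring of the plane curve. -/
def planeMk (K : Type) [Field K] : K[X][X] →+* PlaneRing K := Ideal.Quotient.mk _

lemma planeMk_planePoly (K : Type) [Field K] : planeMk K (planePoly K) = 0 :=
  Ideal.Quotient.eq_zero_iff_mem.mpr (Ideal.mem_span_singleton_self _)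

instance (K : Type) [Field K] : Algebra K (PlaneRing K) :=
  ((planeMk K).comp (C.comp C)).toAlgebra

instance (K R : Type) [Field K] [CommRing R] [Algebra R K] : Algebra R (PlaneRing K) :=
  ((algebraMap K (PlaneRing K)).comp (algebraMap R K)).toAlgebra

instance : IsDomain (PlaneRing K) :=
  have := (Ideal.span_singleton_prime (prime_planePoly K).ne_zero).mpr (prime_planePoly K)
  inferInstanceAs (IsDomain (K[X][X] ⧸ Ideal.span {planePoly K}))

end Squares

end PlaneModel

/-! ### The chart `x₂ = 1` after extension of the base field -/

namespace GenusFive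

open PlaneModel TensorProduct

section PlaneChart

open Polynomial

lemma three_eq_zero_of_algebra (B : Type*) [CommRing B] [Algebra (ZMod 3) B] : (3 : B) = 0 := by
  have := congrArg (algebraMap (ZMod 3) B) (show (3 : ZMod 3) = 0 by decide)
  simpa only [map_ofNat, map_zero] using this

/-- The coordinates `(λ, 1, z, λ μ, μ)` parametrizing the chart `x₂ = 1`. -/
def planeCoord {B : Type*} [CommRing B] (l m : B) : Fin 5 → B :=
  ![l, 1, l ^ 2 * m ^ 2 - l ^ 2 - m ^ 2, l * m, m]

lemma aeval_planeCoord {B : Type*} [CommRing B] [Algebra (ZMod 3) B] (l m : B)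
    (h : (l ^ 2 - 1) ^ 2 * m ^ 4 + (l ^ 2 * (l ^ 2 - 1) - 1) * m ^ 2 + (l ^ 4 - l ^ 2 - l) = 0)
    {p : MvPolynomial (Fin 5) (ZMod 3)} (hp : p ∈ chartIdeal quadric 1) :
    MvPolynomial.aeval (planeCoord l m) p = 0 := by
  suffices chartIdeal quadric 1 ≤
    RingHom.ker (MvPolynomial.aeval (R := ZMod 3) (planeCoord l m)) from this hp
  have h3 := three_eq_zero_of_algebra B
  refine Ideal.span_le.mpr ?_
  rintro _ ⟨j, rfl⟩
  change MvPolynomial.aeval _ _ = 0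
  refine Fin.cases ?_ (fun j => ?_) j
  · simp [planeCoord]
  · rw [Fin.cons_succ]
    fin_cases j
    · simp [quadric, planeCoord]
      linear_combination h + h3 * (l + l ^ 2 * m ^ 2 - l ^ 4 * m ^ 2)
    · simp [quadric, planeCoord]
      ring
    · simp [quadric, planeCoord]
      linear_combination -h + h3 * (l ^ 4 * m ^ 2 - l ^ 2 * m ^ 2)

variable (K : Type) [Field K] [Algebra (ZMod 3) K]

instance (priority := low) charP_three : CharP K 3 :=
  charP_of_injective_algebraMap (algebraMap (ZMod 3) K).injective 3

/-- The class of `λ` in the plane model. -/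
def planeL : PlaneRing K := planeMk K (Polynomial.C X)

/-- The class of `μ` in the plane model. -/
def planeM : PlaneRing K := planeMk K X

omit [Algebra (ZMod 3) K] in
lemma planeL_planeM :
    (planeL K ^ 2 - 1) ^ 2 * planeM K ^ 4 + (planeL K ^ 2 * (planeL K ^ 2 - 1) - 1) * planeM K ^ 2
      + (planeL K ^ 4 - planeL K ^ 2 - planeL K) = 0 := by
  have h := planeMk_planePoly K
  simp only [planePoly, map_add, map_sub, map_mul, map_pow, map_one] at h
  exact h

/-- The chart `x₂ = 1` maps to the plane model. -/
def chartToPlane : ChartRing quadric 1 →ₐ[ZMod 3] PlaneRing K :=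
  Ideal.Quotient.liftₐ _ (MvPolynomial.aeval (planeCoord (planeL K) (planeM K)))
    fun _ ha => aeval_planeCoord (planeL K) (planeM K) (planeL_planeM K) ha

lemma chartToPlane_X (i : Fin 5) :
    chartToPlane K (Ideal.Quotient.mk _ (MvPolynomial.X i)) = planeCoord (planeL K) (planeM K) i :=
  MvPolynomial.aeval_X _ _

/-- The scalars of the plane model. -/
def scalarToPlane : K →ₐ[ZMod 3] PlaneRing K where
  __ := algebraMap K (PlaneRing K)
  commutes' _ := rfl

/-- The base change to `K` of the chart `x₂ = 1` maps to the plane model over `K`. -/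
def chartTensorToPlane : ChartRing quadric 1 ⊗[ZMod 3] K →ₐ[ZMod 3] PlaneRing K :=
  Algebra.TensorProduct.productMap (chartToPlane K) (scalarToPlane K)

lemma mk_chart_quadric (i : Fin 5) (l : Fin 3) :
    Ideal.Quotient.mk (chartIdeal quadric i) (quadric l) = 0 :=
  Ideal.Quotient.eq_zero_iff_mem.mpr
    (span_le_chartIdeal quadric i (Ideal.subset_span (Set.mem_range_self l)))

/-- The homogeneous coordinates restricted to the chart `x_i = 1`. -/
abbrev chartCoord (i j : Fin 5) : ChartRing quadric i :=
  Ideal.Quotient.mk _ (MvPolynomial.X j)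

lemma chartCoord_quadric_zero (i : Fin 5) :
    2 * chartCoord i 0 * chartCoord i 1 + chartCoord i 2 * chartCoord i 1
      + chartCoord i 2 ^ 2 - chartCoord i 3 ^ 2 = 0 := by
  have h := mk_chart_quadric i 0
  rw [quadric_zero] at h
  simpa only [map_sub, map_add, map_mul, map_pow, map_ofNat] using h

lemma chartCoord_quadric_one (i : Fin 5) :
    chartCoord i 4 * chartCoord i 0 - chartCoord i 3 * chartCoord i 1 = 0 := by
  have h := mk_chart_quadric i 1
  rw [quadric_one] at h
  simpa only [map_sub, map_add, map_mul, map_pow, map_ofNat] using h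

lemma chartCoord_quadric_two (i : Fin 5) :
    chartCoord i 0 ^ 2 + chartCoord i 0 * chartCoord i 1
      - chartCoord i 2 ^ 2 + chartCoord i 4 ^ 2 = 0 := by
  have h := mk_chart_quadric i 2
  rw [quadric_two] at h
  simpa only [map_sub, map_add, map_mul, map_pow, map_ofNat] using h

lemma chartCoord_self (i : Fin 5) : chartCoord i i = 1 := mk_X_self quadric i

lemma chartCoord_eq_planeCoord (i : Fin 5) :
    chartCoord 1 i = planeCoord (chartCoord 1 0) (chartCoord 1 4) i := by
  have h0 := chartCoord_quadric_zero 1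
  have h1 := chartCoord_quadric_one 1
  have h2 := chartCoord_quadric_two 1
  have h3 := three_eq_zero_of_algebra (ChartRing quadric 1)
  rw [chartCoord_self] at h0 h1 h2
  have hx3 : chartCoord 1 3 = chartCoord 1 0 * chartCoord 1 4 := by linear_combination -h1
  fin_cases i
  · rfl
  · exact chartCoord_self 1
  · change chartCoord 1 2 = chartCoord 1 0 ^ 2 * chartCoord 1 4 ^ 2 - chartCoord 1 0 ^ 2
      - chartCoord 1 4 ^ 2
    rw [← mul_pow, ← hx3]
    linear_combination h0 + h2 - chartCoord 1 0 * h3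
  · exact hx3
  · rfl

lemma chartCoord_planePoly : (chartCoord 1 0 ^ 2 - 1) ^ 2 * chartCoord 1 4 ^ 4
    + (chartCoord 1 0 ^ 2 * (chartCoord 1 0 ^ 2 - 1) - 1) * chartCoord 1 4 ^ 2
      + (chartCoord 1 0 ^ 4 - chartCoord 1 0 ^ 2 - chartCoord 1 0) = 0 := by
  have h := chartCoord_eq_planeCoord 2
  change chartCoord 1 2 = chartCoord 1 0 ^ 2 * chartCoord 1 4 ^ 2 - chartCoord 1 0 ^ 2
      - chartCoord 1 4 ^ 2 at h
  have h2 := chartCoord_quadric_two 1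
  have h3 := three_eq_zero_of_algebra (ChartRing quadric 1)
  rw [chartCoord_self, h] at h2
  linear_combination - h2 + h3 *
    (chartCoord 1 0 ^ 4 * chartCoord 1 4 ^ 2 - chartCoord 1 0 ^ 2 * chartCoord 1 4 ^ 2)

variable {K} in
/-- A solution of the equation of the plane model gives a homomorphism out of it. -/
def planeLift {T : Type*} [CommRing T] [Algebra (ZMod 3) T] (ι : K →ₐ[ZMod 3] T) (l m : T)
    (h : (l ^ 2 - 1) ^ 2 * m ^ 4 + (l ^ 2 * (l ^ 2 - 1) - 1) * m ^ 2 + (l ^ 4 - l ^ 2 - l) = 0) :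
    PlaneRing K →ₐ[ZMod 3] T where
  __ := (Ideal.Quotient.lift _ (eval₂RingHom (eval₂RingHom (ι : K →+* T) l) m) (by
    suffices Ideal.span {planePoly K} ≤
      RingHom.ker (eval₂RingHom (eval₂RingHom (ι : K →+* T) l) m) from fun a ha => this ha
    rw [Ideal.span_le, Set.singleton_subset_iff]
    change eval₂RingHom _ _ _ = 0
    have hX : eval₂RingHom (eval₂RingHom (ι : K →+* T) l) m X = m := eval₂_X _ _
    have hC (p : K[X]) : eval₂RingHom (eval₂RingHom (ι : K →+* T) l) m (Polynomial.C p) =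
      eval₂RingHom (ι : K →+* T) l p := eval₂_C _ _
    have hX' : eval₂RingHom (ι : K →+* T) l X = l := eval₂_X _ _
    rw [← h]
    simp only [planePoly, map_add, map_sub, map_mul, map_pow, map_one, hX, hC, hX']) :
      PlaneRing K →+* T)
  commutes' c := by
    change eval₂RingHom _ _ (Polynomial.C (Polynomial.C (algebraMap (ZMod 3) K c))) = _
    simp

section planeLift

variable {K} {T : Type*} [CommRing T] [Algebra (ZMod 3) T] (ι : K →ₐ[ZMod 3] T) (l m : T)
    (h : (l ^ 2 - 1) ^ 2 * m ^ 4 + (l ^ 2 * (l ^ 2 - 1) - 1) * m ^ 2 + (l ^ 4 - l ^ 2 - l) = 0)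

lemma planeLift_planeL : planeLift ι l m h (planeL K) = l := by
  change eval₂RingHom (eval₂RingHom (ι : K →+* T) l) m (Polynomial.C X) = l
  simp

lemma planeLift_planeM : planeLift ι l m h (planeM K) = m := by
  change eval₂RingHom (eval₂RingHom (ι : K →+* T) l) m X = m
  simp

lemma planeLift_scalar (c : K) : planeLift ι l m h (scalarToPlane K c) = ι c := by
  change eval₂RingHom (eval₂RingHom (ι : K →+* T) l) m (Polynomial.C (Polynomial.C c)) = _
  simp

end planeLift

lemma map_planeCoord {B T : Type*} [CommRing B] [CommRing T] (f : B →+* T) (l m : B) (i : Fin 5) :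
    f (planeCoord l m i) = planeCoord (f l) (f m) i := by
  fin_cases i <;> simp [planeCoord]

section planeLiftOfChart

variable {K} {T : Type*} [CommRing T] [Algebra (ZMod 3) T] (j : ChartRing quadric 1 →ₐ[ZMod 3] T)
  (ι : K →ₐ[ZMod 3] T)

lemma map_chartCoord_planePoly :
    (j (chartCoord 1 0) ^ 2 - 1) ^ 2 * j (chartCoord 1 4) ^ 4
      + (j (chartCoord 1 0) ^ 2 * (j (chartCoord 1 0) ^ 2 - 1) - 1) * j (chartCoord 1 4) ^ 2
      + (j (chartCoord 1 0) ^ 4 - j (chartCoord 1 0) ^ 2 - j (chartCoord 1 0)) = 0 := by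
  rw [← map_zero j, ← chartCoord_planePoly]
  simp only [map_sub, map_add, map_mul, map_pow, map_one]

/-- Homomorphisms from the chart `x₂ = 1` and from `K` give one from the plane model. -/
def planeLiftOfChart : PlaneRing K →ₐ[ZMod 3] T :=
  planeLift ι (j (chartCoord 1 0)) (j (chartCoord 1 4)) (map_chartCoord_planePoly j)

lemma planeLiftOfChart_chartToPlane (x : ChartRing quadric 1) :
    planeLiftOfChart j ι (chartToPlane K x) = j x := by
  suffices (planeLiftOfChart j ι).comp (chartToPlane K) = j from AlgHom.congr_fun this x
  apply Ideal.Quotient.algHom_ext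
  apply MvPolynomial.algHom_ext
  intro i
  change planeLiftOfChart j ι (chartToPlane K (chartCoord 1 i)) = j (chartCoord 1 i)
  rw [chartToPlane_X, chartCoord_eq_planeCoord]
  refine (map_planeCoord (planeLiftOfChart j ι).toRingHom _ _ i).trans
    (Eq.trans ?_ (map_planeCoord j.toRingHom _ _ i).symm)
  exact congrArg₂ (fun a b => planeCoord a b i) (planeLift_planeL _ _ _ _)
    (planeLift_planeM _ _ _ _)

lemma planeLiftOfChart_scalar (c : K) : planeLiftOfChart j ι (scalarToPlane K c) = ι c :=
  planeLift_scalar _ _ _ _ c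

end planeLiftOfChart

lemma chartTensorToPlane_injective : Function.Injective (chartTensorToPlane K) := by
  let ψ : PlaneRing K →ₐ[ZMod 3] ChartRing quadric 1 ⊗[ZMod 3] K :=
    planeLiftOfChart (T := ChartRing quadric 1 ⊗[ZMod 3] K)
      Algebra.TensorProduct.includeLeft Algebra.TensorProduct.includeRight
  have key : ψ.comp (chartTensorToPlane K) = AlgHom.id _ _ := by
    apply Algebra.TensorProduct.ext
    · ext x : 1
      change ψ (chartTensorToPlane K (x ⊗ₜ 1)) = x ⊗ₜ 1
      rw [chartTensorToPlane, Algebra.TensorProduct.productMap_apply_tmul, map_one, mul_one]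
      exact planeLiftOfChart_chartToPlane _ _ x
    · ext c : 1
      change ψ (chartTensorToPlane K (1 ⊗ₜ c)) = 1 ⊗ₜ c
      rw [chartTensorToPlane, Algebra.TensorProduct.productMap_apply_tmul, map_one, one_mul]
      exact planeLiftOfChart_scalar _ _ c
  exact Function.LeftInverse.injective (g := ψ) fun x => AlgHom.congr_fun key x

/-- The chart `x₂ = 1` is geometrically integral, being isomorphic to the plane model. -/
lemma isDomain_chart_tensor : IsDomain (ChartRing quadric 1 ⊗[ZMod 3] K) :=
  (chartTensorToPlane_injective K).isDomain (chartTensorToPlane K).toRingHom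

end PlaneChart

end GenusFive

/-! ### Generators of the homogeneous coordinate ring over `𝔽₃[x₂, x₃]` -/

namespace GenusFive

section NormalForm

variable {B : Type*} [CommRing B] [Algebra (ZMod 3) B] (x : Fin 5 → B)

/-- The elements `1, x₁, x₄, x₅, x₁², x₁x₄, x₅x₄, x₁²x₄`, which form a basis of the homogeneous
coordinate ring of `C` over `𝔽₃[x₂, x₃]`. -/
def normalBasis : Fin 8 → B :=
  ![1, x 0, x 3, x 4, x 0 ^ 2, x 0 * x 3, x 4 * x 3, x 0 ^ 2 * x 3]

/-- The degrees of the elements of `normalBasis`. -/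
def normalDegree : Fin 8 → ℕ := ![0, 1, 1, 1, 2, 2, 2, 3]

/-- The element `x₂ᵘ x₃ᵛ e_j` for `e = normalBasis`. -/
def normalMon (u v : ℕ) (j : Fin 8) : B := x 1 ^ u * x 2 ^ v * normalBasis x j

/-- The span of the elements `x₂ᵘ x₃ᵛ e_j` of degree `n`. -/
def normalSpan (n : ℕ) : Submodule (ZMod 3) B :=
  Submodule.span (ZMod 3) {y | ∃ u v j, u + v + normalDegree j = n ∧ y = normalMon x u v j}

lemma normalMon_mem {n : ℕ} (u v : ℕ) (j : Fin 8) (h : u + v + normalDegree j = n := by rfl) :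
    normalMon x u v j ∈ normalSpan x n :=
  Submodule.subset_span ⟨u, v, j, h, rfl⟩

/-- The span of the normal forms is stable under multiplication by `a` if the products `a e_j` have
normal forms. -/
lemma mul_mem_normalSpan {a : B} {s : ℕ}
    (h : ∀ j, a * normalBasis x j ∈ normalSpan x (normalDegree j + s)) {n : ℕ} {y : B}
    (hy : y ∈ normalSpan x n) : a * y ∈ normalSpan x (n + s) := by
  have hmon (u v : ℕ) {n : ℕ} {y : B} (hy : y ∈ normalSpan x n) :
      x 1 ^ u * x 2 ^ v * y ∈ normalSpan x (u + v + n) := by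
    induction hy using Submodule.span_induction with
    | mem y hy =>
      obtain ⟨u', v', j, rfl, rfl⟩ := hy
      have : x 1 ^ u * x 2 ^ v * normalMon x u' v' j = normalMon x (u + u') (v + v') j := by
        unfold normalMon
        ring
      rw [this]
      exact normalMon_mem x _ _ _ (by ring)
    | zero => simp
    | add y z _ _ hy hz => rw [mul_add]; exact add_mem hy hz
    | smul c y _ hy => rw [mul_smul_comm]; exact Submodule.smul_mem _ _ hy
  induction hy using Submodule.span_induction with
  | mem y hy =>
    obtain ⟨u, v, j, rfl, rfl⟩ := hy
    have : a * normalMon x u v j = x 1 ^ u * x 2 ^ v * (a * normalBasis x j) := by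
      unfold normalMon
      ring
    rw [this, add_assoc]
    exact hmon u v (h j)
  | zero => simp
  | add y z _ _ hy hz => rw [mul_add]; exact add_mem hy hz
  | smul c y _ hy => rw [mul_smul_comm]; exact Submodule.smul_mem _ _ hy

variable (hx : ∀ l, MvPolynomial.aeval x (quadric l) = 0)

include hx

lemma quadric_relations : 2 * x 0 * x 1 + x 2 * x 1 + x 2 ^ 2 - x 3 ^ 2 = 0 ∧
    x 4 * x 0 - x 3 * x 1 = 0 ∧ x 0 ^ 2 + x 0 * x 1 - x 2 ^ 2 + x 4 ^ 2 = 0 := by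
  refine ⟨?_, ?_, ?_⟩
  · simpa [quadric_zero] using hx 0
  · simpa [quadric_one] using hx 1
  · simpa [quadric_two] using hx 2

/-- The products `x₁ e_j`. With `x₄ e_j` and `x₅ e_j`, they form the multiplication table of the
homogeneous coordinate ring over `𝔽₃[x₂, x₃]`. -/
lemma coord_zero_mul_basis_mem (j : Fin 8) :
    x 0 * normalBasis x j ∈ normalSpan x (normalDegree j + 1) := by
  obtain ⟨h0, h1, h2⟩ := quadric_relations x hx
  have h3 := three_eq_zero_of_algebra B
  fin_cases j
  · have h : x 0 * normalBasis x 0 =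
        normalMon x 0 0 1 := by
      unfold normalMon
      simp only [normalBasis, Matrix.cons_val]
      ring
    exact h ▸ normalMon_mem x 0 0 1
  · have h : x 0 * normalBasis x 1 =
        normalMon x 0 0 4 := by
      unfold normalMon
      simp only [normalBasis, Matrix.cons_val]
      ring
    exact h ▸ normalMon_mem x 0 0 4
  · have h : x 0 * normalBasis x 2 =
        normalMon x 0 0 5 := by
      unfold normalMon
      simp only [normalBasis, Matrix.cons_val]
      ring
    exact h ▸ normalMon_mem x 0 0 5
  · have h : x 0 * normalBasis x 3 =
        normalMon x 1 0 2 := by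
      unfold normalMon
      simp only [normalBasis, Matrix.cons_val]
      linear_combination (1) * h1
    exact h ▸ normalMon_mem x 1 0 2
  · have h : x 0 * normalBasis x 4 =
        normalMon x 0 2 1 - normalMon x 1 0 4 - normalMon x 1 0 6 := by
      unfold normalMon
      simp only [normalBasis, Matrix.cons_val]
      linear_combination (- x 4) * h1 + (x 0) * h2
    exact h ▸ sub_mem (sub_mem (normalMon_mem x 0 2 1) (normalMon_mem x 1 0 4))
      (normalMon_mem x 1 0 6)
  · have h : x 0 * normalBasis x 5 =
        normalMon x 0 0 7 := by
      unfold normalMon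
      simp only [normalBasis, Matrix.cons_val]
      ring
    exact h ▸ normalMon_mem x 0 0 7
  · have h : x 0 * normalBasis x 6 =
        normalMon x 1 2 0 + normalMon x 2 1 0 - normalMon x 2 0 1 := by
      unfold normalMon
      simp only [normalBasis, Matrix.cons_val]
      linear_combination (- x 1) * h0 + (x 3) * h1 + (x 0 * x 1 ^ 2) * h3
    exact h ▸ sub_mem (add_mem (normalMon_mem x 1 2 0) (normalMon_mem x 2 1 0))
      (normalMon_mem x 2 0 1)
  · have h : x 0 * normalBasis x 7 =
        normalMon x 3 0 2 + normalMon x 0 2 5 - normalMon x 1 2 3 - normalMon x 2 1 3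
          - normalMon x 1 0 7 := by
      unfold normalMon
      simp only [normalBasis, Matrix.cons_val]
      linear_combination (x 1 * x 4) * h0 + (x 1 ^ 2 - x 3 * x 4) * h1 + (x 0 * x 3) * h2
        + (- x 0 * x 1 ^ 2 * x 4) * h3
    exact h ▸ sub_mem (sub_mem (sub_mem (add_mem (normalMon_mem x 3 0 2)
      (normalMon_mem x 0 2 5)) (normalMon_mem x 1 2 3)) (normalMon_mem x 2 1 3))
      (normalMon_mem x 1 0 7)

lemma coord_three_mul_basis_mem (j : Fin 8) :
    x 3 * normalBasis x j ∈ normalSpan x (normalDegree j + 1) := by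
  obtain ⟨h0, h1, h2⟩ := quadric_relations x hx
  have h3 := three_eq_zero_of_algebra B
  fin_cases j
  · have h : x 3 * normalBasis x 0 =
        normalMon x 0 0 2 := by
      unfold normalMon
      simp only [normalBasis, Matrix.cons_val]
      ring
    exact h ▸ normalMon_mem x 0 0 2
  · have h : x 3 * normalBasis x 1 =
        normalMon x 0 0 5 := by
      unfold normalMon
      simp only [normalBasis, Matrix.cons_val]
      ring
    exact h ▸ normalMon_mem x 0 0 5
  · have h : x 3 * normalBasis x 2 =
        normalMon x 0 2 0 + normalMon x 1 1 0 - normalMon x 1 0 1 := by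
      unfold normalMon
      simp only [normalBasis, Matrix.cons_val]
      linear_combination (- 1) * h0 + (x 0 * x 1) * h3
    exact h ▸ sub_mem (add_mem (normalMon_mem x 0 2 0) (normalMon_mem x 1 1 0))
      (normalMon_mem x 1 0 1)
  · have h : x 3 * normalBasis x 3 =
        normalMon x 0 0 6 := by
      unfold normalMon
      simp only [normalBasis, Matrix.cons_val]
      ring
    exact h ▸ normalMon_mem x 0 0 6
  · have h : x 3 * normalBasis x 4 =
        normalMon x 0 0 7 := by
      unfold normalMon
      simp only [normalBasis, Matrix.cons_val]
      ring
    exact h ▸ normalMon_mem x 0 0 7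
  · have h : x 3 * normalBasis x 5 =
        normalMon x 0 2 1 + normalMon x 1 1 1 - normalMon x 1 0 4 := by
      unfold normalMon
      simp only [normalBasis, Matrix.cons_val]
      linear_combination (- x 0) * h0 + (x 0 ^ 2 * x 1) * h3
    exact h ▸ sub_mem (add_mem (normalMon_mem x 0 2 1) (normalMon_mem x 1 1 1))
      (normalMon_mem x 1 0 4)
  · have h : x 3 * normalBasis x 6 =
        normalMon x 0 2 3 + normalMon x 1 1 3 - normalMon x 2 0 2 := by
      unfold normalMon
      simp only [normalBasis, Matrix.cons_val]
      linear_combination (- x 4) * h0 + (- x 1) * h1 + (x 0 * x 1 * x 4) * h3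
    exact h ▸ sub_mem (add_mem (normalMon_mem x 0 2 3) (normalMon_mem x 1 1 3))
      (normalMon_mem x 2 0 2)
  · have h : x 3 * normalBasis x 7 =
        normalMon x 0 2 4 + normalMon x 1 1 4 + normalMon x 2 0 4 + normalMon x 2 0 6
          - normalMon x 1 2 1 := by
      unfold normalMon
      simp only [normalBasis, Matrix.cons_val]
      linear_combination (x 0 * x 1 - x 2 ^ 2 + x 4 ^ 2) * h0 + (x 1 * x 4) * h1 + (- x 1 * x 2
        - x 2 ^ 2 + x 3 ^ 2) * h2 + (- x 0 ^ 2 * x 1 ^ 2 + x 0 * x 1 * x 2 ^ 2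
        - x 0 * x 1 * x 4 ^ 2) * h3
    exact h ▸ sub_mem (add_mem (add_mem (add_mem (normalMon_mem x 0 2 4)
      (normalMon_mem x 1 1 4)) (normalMon_mem x 2 0 4)) (normalMon_mem x 2 0 6))
      (normalMon_mem x 1 2 1)

lemma coord_four_mul_basis_mem (j : Fin 8) :
    x 4 * normalBasis x j ∈ normalSpan x (normalDegree j + 1) := by
  obtain ⟨h0, h1, h2⟩ := quadric_relations x hx
  have h3 := three_eq_zero_of_algebra B
  fin_cases j
  · have h : x 4 * normalBasis x 0 =
        normalMon x 0 0 3 := by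
      unfold normalMon
      simp only [normalBasis, Matrix.cons_val]
      ring
    exact h ▸ normalMon_mem x 0 0 3
  · have h : x 4 * normalBasis x 1 =
        normalMon x 1 0 2 := by
      unfold normalMon
      simp only [normalBasis, Matrix.cons_val]
      linear_combination (1) * h1
    exact h ▸ normalMon_mem x 1 0 2
  · have h : x 4 * normalBasis x 2 =
        normalMon x 0 0 6 := by
      unfold normalMon
      simp only [normalBasis, Matrix.cons_val]
      ring
    exact h ▸ normalMon_mem x 0 0 6
  · have h : x 4 * normalBasis x 3 =
        normalMon x 0 2 0 - normalMon x 1 0 1 - normalMon x 0 0 4 := by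
      unfold normalMon
      simp only [normalBasis, Matrix.cons_val]
      linear_combination (1) * h2
    exact h ▸ sub_mem (sub_mem (normalMon_mem x 0 2 0) (normalMon_mem x 1 0 1))
      (normalMon_mem x 0 0 4)
  · have h : x 4 * normalBasis x 4 =
        normalMon x 1 0 5 := by
      unfold normalMon
      simp only [normalBasis, Matrix.cons_val]
      linear_combination (x 0) * h1
    exact h ▸ normalMon_mem x 1 0 5
  · have h : x 4 * normalBasis x 5 =
        normalMon x 1 2 0 + normalMon x 2 1 0 - normalMon x 2 0 1 := by
      unfold normalMon
      simp only [normalBasis, Matrix.cons_val]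
      linear_combination (- x 1) * h0 + (x 3) * h1 + (x 0 * x 1 ^ 2) * h3
    exact h ▸ sub_mem (add_mem (normalMon_mem x 1 2 0) (normalMon_mem x 2 1 0))
      (normalMon_mem x 2 0 1)
  · have h : x 4 * normalBasis x 6 =
        normalMon x 0 2 2 - normalMon x 1 0 5 - normalMon x 0 0 7 := by
      unfold normalMon
      simp only [normalBasis, Matrix.cons_val]
      linear_combination (x 3) * h2
    exact h ▸ sub_mem (sub_mem (normalMon_mem x 0 2 2) (normalMon_mem x 1 0 5))
      (normalMon_mem x 0 0 7)
  · have h : x 4 * normalBasis x 7 =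
        normalMon x 1 2 1 + normalMon x 2 1 1 - normalMon x 2 0 4 := by
      unfold normalMon
      simp only [normalBasis, Matrix.cons_val]
      linear_combination (- x 0 * x 1) * h0 + (x 0 * x 3) * h1 + (x 0 ^ 2 * x 1 ^ 2) * h3
    exact h ▸ sub_mem (add_mem (normalMon_mem x 1 2 1) (normalMon_mem x 2 1 1))
      (normalMon_mem x 2 0 4)

lemma coord_mul_mem (i : Fin 5) {n : ℕ} {y : B} (hy : y ∈ normalSpan x n) :
    x i * y ∈ normalSpan x (n + 1) := by
  refine mul_mem_normalSpan x (fun j => ?_) hy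
  fin_cases i
  · exact coord_zero_mul_basis_mem x hx j
  · have : x 1 * normalBasis x j = normalMon x 1 0 j := by simp [normalMon]
    exact this ▸ normalMon_mem x 1 0 j (by ring)
  · have : x 2 * normalBasis x j = normalMon x 0 1 j := by simp [normalMon]
    exact this ▸ normalMon_mem x 0 1 j (by ring)
  · exact coord_three_mul_basis_mem x hx j
  · exact coord_four_mul_basis_mem x hx j

/-- Every form of degree `n` on `C` is a combination of the elements `x₂ᵘ x₃ᵛ e_j` of degree `n`:
their span is stable under multiplication by the coordinates. -/
lemma aeval_mem_normalSpan {n : ℕ} {p : MvPolynomial (Fin 5) (ZMod 3)} (hp : p.IsHomogeneous n) :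
    MvPolynomial.aeval x p ∈ normalSpan x n := by
  have hpow (i : Fin 5) (m : ℕ) {n : ℕ} {y : B} (hy : y ∈ normalSpan x n) :
      x i ^ m * y ∈ normalSpan x (n + m) := by
    induction m with
    | zero => simpa using hy
    | succ m ih =>
      rw [pow_succ', mul_assoc, ← add_assoc]
      exact coord_mul_mem x hx i ih
  have hprod (d : Fin 5 →₀ ℕ) (s : Finset (Fin 5)) :
      ∏ i ∈ s, x i ^ d i ∈ normalSpan x (∑ i ∈ s, d i) := by
    induction s using Finset.induction_on with
    | empty => simpa [normalMon, normalBasis] using normalMon_mem x 0 0 0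
    | insert i s hi ih =>
      rw [Finset.prod_insert hi, Finset.sum_insert hi, add_comm]
      exact hpow i _ ih
  rw [p.as_sum, map_sum]
  refine Submodule.sum_mem _ fun d hd => ?_
  rw [MvPolynomial.aeval_monomial, ← Algebra.smul_def, Finsupp.prod]
  refine Submodule.smul_mem _ _ ?_
  have := hp (MvPolynomial.mem_support_iff.mp hd)
  rw [← this]
  convert hprod d d.support
  simp [Finsupp.weight_apply, Finsupp.sum]

end NormalForm

lemma mem_normalSpan_of_mem_coordinateGrading {n : ℕ}
    {a : MvPolynomial (Fin 5) (ZMod 3) ⧸ Ideal.span (Set.range quadric)}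
    (ha : a ∈ coordinateGrading quadric n) : a ∈ normalSpan (coord quadric) n := by
  obtain ⟨p, hp, rfl⟩ := ha
  have h : (Ideal.Quotient.mkₐ (ZMod 3) (Ideal.span (Set.range quadric))) =
      MvPolynomial.aeval (coord quadric) := by
    apply MvPolynomial.algHom_ext
    intro i
    rw [MvPolynomial.aeval_X]
    rfl
  change Ideal.Quotient.mkₐ (ZMod 3) _ p ∈ _
  rw [h]
  refine aeval_mem_normalSpan _ (fun l => ?_) hp
  rw [← h]
  exact mk_quadric l

end GenusFive

/-! ### The curve over the line with coordinates `(x₂ : x₃)` -/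

namespace GenusFive

section AdjoinRoot

open Polynomial

lemma modByMonicHom_algebraMap_mul_root_pow {R : Type*} [CommRing R] {f : R[X]} (hf : f.Monic)
    (c : R) {i : ℕ} (hi : i < f.natDegree) :
    AdjoinRoot.modByMonicHom hf (algebraMap R _ c * AdjoinRoot.root f ^ i) =
      Polynomial.C c * X ^ i := by
  nontriviality R
  have : algebraMap R _ c * AdjoinRoot.root f ^ i = AdjoinRoot.mk f (Polynomial.C c * X ^ i) := by
    rw [map_mul, map_pow, AdjoinRoot.mk_X, AdjoinRoot.mk_C, AdjoinRoot.algebraMap_eq]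
  rw [this, AdjoinRoot.modByMonicHom_mk, modByMonic_eq_self_iff hf]
  refine (degree_C_mul_X_pow_le i c).trans_lt ?_
  rw [degree_eq_natDegree hf.ne_zero]
  exact_mod_cast hi

end AdjoinRoot

section Tower

open Polynomial

variable {R : Type} [CommRing R] (t : R)

/-- The equation of `x₁` on `C` over the point `(x₂ : x₃) = (1 : t)` of the line. It results from
the first quadric by substituting `x₄ = x₁x₅` and `x₅² = t² - x₁² - x₁`, which are the other two. -/
def quarticPoly : R[X] :=
  X ^ 4 + X ^ 3 - Polynomial.C (t ^ 2) * X ^ 2 - X + Polynomial.C (t + t ^ 2)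

lemma natDegree_quarticPoly [Nontrivial R] : (quarticPoly t).natDegree = 4 := by
  unfold quarticPoly
  compute_degree!

lemma monic_quarticPoly [Nontrivial R] : (quarticPoly t).Monic := by
  unfold quarticPoly
  monicity!

/-- The algebra generated by `x₁`. -/
abbrev QuarticAlgebra : Type := AdjoinRoot (quarticPoly t)

/-- The equation `x₅² = t² - x₁² - x₁` of `x₅` over the algebra generated by `x₁`. -/
def conicPoly : (QuarticAlgebra t)[X] :=
  X ^ 2 + Polynomial.C (AdjoinRoot.root (quarticPoly t) ^ 2 + AdjoinRoot.root (quarticPoly t)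
    - algebraMap R _ (t ^ 2))

instance [Nontrivial R] : Nontrivial (QuarticAlgebra t) := by
  refine ⟨⟨0, 1, fun h => ?_⟩⟩
  have := modByMonicHom_algebraMap_mul_root_pow (monic_quarticPoly t) 1 (i := 0)
    (by rw [natDegree_quarticPoly]; norm_num)
  rw [pow_zero, mul_one, map_one, ← h, map_zero, map_one, pow_zero, mul_one] at this
  exact zero_ne_one this

lemma natDegree_conicPoly [Nontrivial R] : (conicPoly t).natDegree = 2 := by
  unfold conicPoly
  compute_degree!

lemma monic_conicPoly [Nontrivial R] : (conicPoly t).Monic := by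
  unfold conicPoly
  monicity!

/-- The restriction of the curve to the locus `(x₂ : x₃) = (1 : t)`, as a tower of two
monogenic algebras, generated by `x₁` and `x₅`. -/
def TowerAlgebra : Type := AdjoinRoot (conicPoly t)

instance : CommRing (TowerAlgebra t) := inferInstanceAs (CommRing (AdjoinRoot (conicPoly t)))

instance : Algebra (QuarticAlgebra t) (TowerAlgebra t) :=
  inferInstanceAs (Algebra (QuarticAlgebra t) (AdjoinRoot (conicPoly t)))

instance (k : Type) [CommRing k] [Algebra k R] : Algebra k (TowerAlgebra t) :=
  inferInstanceAs (Algebra k (AdjoinRoot (conicPoly t)))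

instance : IsScalarTower R (QuarticAlgebra t) (TowerAlgebra t) :=
  inferInstanceAs (IsScalarTower R (QuarticAlgebra t) (AdjoinRoot (conicPoly t)))

/-- The coordinate `x₁`. -/
def towerX : TowerAlgebra t :=
  algebraMap (QuarticAlgebra t) (TowerAlgebra t) (AdjoinRoot.root (quarticPoly t))

/-- The coordinate `x₅`. -/
def towerY : TowerAlgebra t := AdjoinRoot.root (conicPoly t)

lemma towerX_relation : towerX t ^ 4 + towerX t ^ 3 - algebraMap R _ t ^ 2 * towerX t ^ 2
    - towerX t + (algebraMap R _ t + algebraMap R _ t ^ 2) = 0 := by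
  have h : aeval (towerX t) (quarticPoly t) = 0 := by
    rw [towerX, aeval_algebraMap_apply, AdjoinRoot.aeval_eq, AdjoinRoot.mk_self, map_zero]
  simpa [quarticPoly] using h

lemma towerY_relation : towerY t ^ 2 + (towerX t ^ 2 + towerX t - algebraMap R _ t ^ 2) = 0 := by
  have h : aeval (R := QuarticAlgebra t) (towerY t) (conicPoly t) = 0 :=
    (AdjoinRoot.aeval_eq _).trans AdjoinRoot.mk_self
  rw [IsScalarTower.algebraMap_apply R (QuarticAlgebra t) (TowerAlgebra t), ← map_pow, ← map_pow]
  simpa only [conicPoly, towerX, map_add, map_sub, map_pow, aeval_X, aeval_C] using h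

/-- The coefficient of `x₁ⁱ x₅ʲ`. -/
def towerCoeff [Nontrivial R] (i j : ℕ) : TowerAlgebra t →ₗ[R] R :=
  (lcoeff R i ∘ₗ AdjoinRoot.modByMonicHom (monic_quarticPoly t)) ∘ₗ
    ((lcoeff (QuarticAlgebra t) j ∘ₗ AdjoinRoot.modByMonicHom (monic_conicPoly t)).restrictScalars
      R : TowerAlgebra t →ₗ[R] QuarticAlgebra t)

/-- The monomial `x₁ⁱ x₅ʲ`. -/
def towerMon (i j : ℕ) : TowerAlgebra t := towerX t ^ i * towerY t ^ j

lemma towerCoeff_mon [Nontrivial R] (i j : ℕ) {i' j' : ℕ} (hi : i' < 4) (hj : j' < 2) :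
    towerCoeff t i j (towerMon t i' j') = if i = i' ∧ j = j' then 1 else 0 := by
  have h1 : AdjoinRoot.modByMonicHom (monic_conicPoly t) (towerMon t i' j') =
      Polynomial.C (AdjoinRoot.root (quarticPoly t) ^ i') * X ^ j' := by
    rw [← modByMonicHom_algebraMap_mul_root_pow _ _ (by rwa [natDegree_conicPoly]), map_pow]
    rfl
  have h2 : AdjoinRoot.modByMonicHom (monic_quarticPoly t) (AdjoinRoot.root (quarticPoly t) ^ i') =
      X ^ i' := by
    have := modByMonicHom_algebraMap_mul_root_pow (monic_quarticPoly t) 1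
      (by rwa [natDegree_quarticPoly])
    simpa using this
  change (AdjoinRoot.modByMonicHom (monic_quarticPoly t)
    ((AdjoinRoot.modByMonicHom (monic_conicPoly t) _).coeff j)).coeff i = _
  rw [h1, coeff_C_mul_X_pow]
  split_ifs with hj' hij hij
  · rw [h2, coeff_X_pow, if_pos hij.1]
  · rw [h2, coeff_X_pow, if_neg fun h => hij ⟨h, hj'⟩]
  · exact absurd hij.2 hj'
  · simp

/-- The coordinates on the tower with respect to `normalBasis`. The element `x₅x₄` is
`- x₁³ - x₁² + t² x₁`, which replaces `x₁³` in the monomial basis. -/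
def towerCoord [Nontrivial R] : Fin 8 → (TowerAlgebra t →ₗ[R] R) :=
  ![towerCoeff t 0 0, towerCoeff t 1 0 + t ^ 2 • towerCoeff t 3 0, towerCoeff t 1 1,
    towerCoeff t 0 1, towerCoeff t 2 0 - towerCoeff t 3 0, towerCoeff t 2 1, -towerCoeff t 3 0,
    towerCoeff t 3 1]

/-- The point of the curve over the tower. -/
def towerPoint : Fin 5 → TowerAlgebra t :=
  ![towerX t, 1, algebraMap R _ t, towerX t * towerY t, towerY t]

lemma aeval_towerPoint [Algebra (ZMod 3) R] (l : Fin 3) :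
    MvPolynomial.aeval (towerPoint t) (quadric l) = 0 := by
  have h3 := three_eq_zero_of_algebra (TowerAlgebra t)
  have hX := towerX_relation t
  have hY := towerY_relation t
  fin_cases l
  · simp [quadric, towerPoint]
    linear_combination hX - towerX t ^ 2 * hY + towerX t * h3
  · simp [quadric, towerPoint]
    ring
  · simp [quadric, towerPoint]
    linear_combination hY

lemma normalBasis_towerPoint (j : Fin 8) : normalBasis (towerPoint t) j =
    ![towerMon t 0 0, towerMon t 1 0, towerMon t 1 1, towerMon t 0 1, towerMon t 2 0, towerMon t 2 1,
      t ^ 2 • towerMon t 1 0 - towerMon t 2 0 - towerMon t 3 0, towerMon t 3 1] j := by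
  have hY := towerY_relation t
  fin_cases j <;>
    simp only [normalBasis, towerPoint, towerMon, Matrix.cons_val, Algebra.smul_def, map_pow] <;>
    simp only [Fin.zero_eta, Fin.mk_one, Fin.reduceFinMk, Matrix.cons_val]
  on_goal 7 => linear_combination towerX t * hY
  all_goals ring

lemma towerCoord_normalBasis [Nontrivial R] (i j : Fin 8) :
    towerCoord t i (normalBasis (towerPoint t) j) = if i = j then 1 else 0 := by
  rw [normalBasis_towerPoint]
  fin_cases j <;> fin_cases i <;> simp [towerCoord, towerCoeff_mon]

end Tower

end GenusFive

/-! ### Restriction of forms to `x₂x₃ ≠ 0` -/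

namespace GenusFive

open HomogeneousLocalization

attribute [local instance] MvPolynomial.gradedAlgebra

section Restriction

/-- The homogeneous coordinate ring of `C`. -/
abbrev CurveRing : Type := MvPolynomial (Fin 5) (ZMod 3) ⧸ Ideal.span (Set.range quadric)

/-- Laurent polynomials over `𝔽₃`, the coordinate ring of the torus in the line with homogeneous
coordinates `(x₂ : x₃)`. -/
abbrev Torus : Type := LaurentPolynomial (ZMod 3)

/-- The algebra of functions on the open subset `x₂x₃ ≠ 0` of `C`, as a tower of monogenic
algebras. -/
abbrev TorusTower : Type := TowerAlgebra (LaurentPolynomial.T 1 : Torus)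

/-- Restriction of forms to `x₂x₃ ≠ 0`, normalized by `x₂ = 1`. -/
def restrictToTorus : CurveRing →ₐ[ZMod 3] TorusTower :=
  Ideal.Quotient.liftₐ _ (MvPolynomial.aeval (towerPoint _)) fun a ha => by
    suffices Ideal.span (Set.range quadric) ≤
      RingHom.ker (MvPolynomial.aeval (R := ZMod 3) (towerPoint (LaurentPolynomial.T 1 : Torus)))
      from this ha
    rw [Ideal.span_le]
    rintro _ ⟨l, rfl⟩
    exact aeval_towerPoint _ l

lemma restrictToTorus_coord (i : Fin 5) :
    restrictToTorus (coord quadric i) = towerPoint _ i :=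
  MvPolynomial.aeval_X _ _

lemma map_normalMon {A B : Type*} [CommRing A] [CommRing B] (f : A →+* B) (x : Fin 5 → A)
    (u v : ℕ) (j : Fin 8) : f (normalMon x u v j) = normalMon (f ∘ x) u v j := by
  have h : f (normalBasis x j) = normalBasis (f ∘ x) j := by
    fin_cases j <;> simp [normalBasis]
  simp [normalMon, h]

lemma restrictToTorus_normalMon (u v : ℕ) (j : Fin 8) :
    restrictToTorus (normalMon (coord quadric) u v j) =
      LaurentPolynomial.T (R := ZMod 3) v •
        normalBasis (towerPoint (LaurentPolynomial.T 1 : Torus)) j := by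
  refine (map_normalMon restrictToTorus.toRingHom _ u v j).trans ?_
  have h : restrictToTorus.toRingHom ∘ coord quadric = towerPoint _ :=
    funext restrictToTorus_coord
  rw [h, Algebra.smul_def]
  simp [normalMon, towerPoint, ← map_pow, LaurentPolynomial.T_pow]

/-- The coefficient of `tⁿ e_j` of a function on `x₂x₃ ≠ 0`. -/
def torusCoeff (n : ℤ) (j : Fin 8) : TorusTower →+ ZMod 3 where
  toFun y := (towerCoord _ j y).coeff n
  map_zero' := by simp
  map_add' y z := by simp

lemma torusCoeff_smul (n m : ℤ) (j l : Fin 8) :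
    torusCoeff n j (LaurentPolynomial.T (R := ZMod 3) m •
        normalBasis (towerPoint (LaurentPolynomial.T 1 : Torus)) l) =
      if m = n ∧ j = l then 1 else 0 := by
  change (towerCoord (LaurentPolynomial.T 1 : Torus) j _).coeff n = _
  rw [map_smul, towerCoord_normalBasis]
  split_ifs with h h' h'
  · simp [h'.1]
  · simp [h] at h' ⊢
    exact h'
  · exact absurd h'.2 h
  · simp

/-- The form of degree `n` with a given restriction to `x₂x₃ ≠ 0`. -/
def formOfRestriction (n : ℕ) : TorusTower →+ CurveRing where
  toFun y := ∑ j : Fin 8, ∑ v ∈ Finset.range (n + 1),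
    torusCoeff v j y • normalMon (coord quadric) (n - normalDegree j - v) v j
  map_zero' := by simp
  map_add' y z := by simp [add_smul, Finset.sum_add_distrib]

lemma formOfRestriction_restrictToTorus {n : ℕ} {a : CurveRing}
    (ha : a ∈ normalSpan (coord quadric) n) : formOfRestriction n (restrictToTorus a) = a := by
  induction ha using Submodule.span_induction with
  | mem y hy =>
    obtain ⟨u, v, j, h, rfl⟩ := hy
    rw [restrictToTorus_normalMon]
    change ∑ j' : Fin 8, ∑ v' ∈ Finset.range (n + 1), torusCoeff v' j' _ • _ = _
    rw [Finset.sum_eq_single j, Finset.sum_eq_single v]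
    · rw [torusCoeff_smul, if_pos ⟨rfl, rfl⟩, one_smul]
      congr 1
      omega
    · intro v' _ hv
      rw [torusCoeff_smul, if_neg, zero_smul]
      rintro ⟨h, -⟩
      exact hv (by exact_mod_cast h.symm)
    · intro hv
      exact absurd (Finset.mem_range.mpr (by omega)) hv
    · intro j' _ hj
      refine Finset.sum_eq_zero fun v' _ => ?_
      rw [torusCoeff_smul, if_neg (fun h => hj h.2), zero_smul]
    · exact fun h => absurd (Finset.mem_univ _) h
  | zero => simp
  | add y z _ _ hy hz => rw [map_add, map_add, hy, hz]
  | smul c y _ hy => rw [map_smul, ZMod.map_smul, hy]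

/-- A form is determined by its restriction to `x₂x₃ ≠ 0`, because the normal basis stays linearly
independent over the Laurent polynomials. -/
lemma restrictToTorus_injOn {n : ℕ} {a : CurveRing} (ha : a ∈ coordinateGrading quadric n)
    (h : restrictToTorus a = 0) : a = 0 := by
  rw [← formOfRestriction_restrictToTorus (mem_normalSpan_of_mem_coordinateGrading ha), h, map_zero]

/-- The coordinate `x₂` is not a zero divisor. -/
lemma eq_zero_of_coord_one_mul {n : ℕ} {a : CurveRing} (ha : a ∈ coordinateGrading quadric n)
    (h : coord quadric 1 * a = 0) : a = 0 := by
  refine restrictToTorus_injOn ha ?_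
  have := congrArg restrictToTorus h
  rwa [map_mul, restrictToTorus_coord, map_zero, show towerPoint _ 1 = 1 from rfl, one_mul] at this

end Restriction

section Away

/-- The equation of the complement of `D₊(x₂) ∩ D₊(x₃)`. -/
abbrev torusEquation : CurveRing := coord quadric 1 * coord quadric 2

lemma torusEquation_mem : torusEquation ∈ coordinateGrading quadric 2 :=
  SetLike.mul_mem_graded (coord_mem quadric 1) (coord_mem quadric 2)

lemma restrictToTorus_torusEquation :
    restrictToTorus torusEquation = algebraMap Torus _ (LaurentPolynomial.T 1) := by
  rw [map_mul, restrictToTorus_coord, restrictToTorus_coord]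
  exact one_mul _

lemma isUnit_restrictToTorus_torusEquation : IsUnit (restrictToTorus torusEquation) := by
  rw [restrictToTorus_torusEquation]
  exact (LaurentPolynomial.isUnit_T 1).map _

/-- Restriction of functions to `x₂x₃ ≠ 0`. -/
def torusFunction : Away (coordinateGrading quadric) torusEquation →+* TorusTower :=
  (IsLocalization.Away.lift (S := Localization.Away torusEquation) torusEquation
    (g := restrictToTorus.toRingHom) isUnit_restrictToTorus_torusEquation).comp (algebraMap _ _)

lemma torusFunction_mk (n : ℕ) (a : CurveRing) (ha : a ∈ coordinateGrading quadric (n • 2)) :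
    torusFunction (Away.mk _ torusEquation_mem n a ha) =
      LaurentPolynomial.T (R := ZMod 3) (-n) • restrictToTorus a := by
  have h : torusFunction (Away.mk _ torusEquation_mem n a ha) *
      restrictToTorus (torusEquation ^ n) = restrictToTorus a := by
    have h1 (x : CurveRing) : (IsLocalization.Away.lift (S := Localization.Away torusEquation)
        torusEquation (g := restrictToTorus.toRingHom) isUnit_restrictToTorus_torusEquation)
        (algebraMap _ _ x) = restrictToTorus x := IsLocalization.Away.lift_eq _ _ _
    rw [← h1, ← h1]
    change (IsLocalization.Away.lift (S := Localization.Away torusEquation)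
        torusEquation (g := restrictToTorus.toRingHom) isUnit_restrictToTorus_torusEquation)
        (Away.mk _ torusEquation_mem n a ha).val * _ = _
    rw [← map_mul, Away.val_mk]
    congr 1
    rw [Localization.mk_eq_mk']
    exact IsLocalization.mk'_spec _ a (⟨torusEquation ^ n, _⟩ : Submonoid.powers torusEquation)
  rw [map_pow, restrictToTorus_torusEquation, ← map_pow, LaurentPolynomial.T_pow, mul_one] at h
  rw [← h, Algebra.smul_def, mul_left_comm, ← map_mul, ← LaurentPolynomial.T_add, neg_add_cancel,
    LaurentPolynomial.T_zero, map_one, mul_one]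

lemma normalMon_mem_graded {A σ : Type*} [CommRing A] [SetLike σ A] (𝒜 : ℕ → σ)
    [SetLike.GradedMonoid 𝒜] {x : Fin 5 → A} (hx : ∀ i, x i ∈ 𝒜 1) {n u v : ℕ} {j : Fin 8}
    (h : u + v + normalDegree j = n) : normalMon x u v j ∈ 𝒜 n := by
  have h1 (i : Fin 5) (m : ℕ) : x i ^ m ∈ 𝒜 m := by
    simpa using SetLike.pow_mem_graded m (hx i)
  have h2 : normalBasis x j ∈ 𝒜 (normalDegree j) := by
    fin_cases j
    · exact SetLike.one_mem_graded 𝒜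
    · exact hx 0
    · exact hx 3
    · exact hx 4
    · exact h1 0 2
    · exact SetLike.mul_mem_graded (hx 0) (hx 3)
    · exact SetLike.mul_mem_graded (hx 4) (hx 3)
    · exact SetLike.mul_mem_graded (h1 0 2) (hx 3)
  subst h
  exact SetLike.mul_mem_graded (SetLike.mul_mem_graded (h1 1 u) (h1 2 v)) h2

lemma normalMon_coord_mem {n : ℕ} {u v : ℕ} {j : Fin 8} (h : u + v + normalDegree j = n) :
    normalMon (coord quadric) u v j ∈ coordinateGrading quadric n :=
  normalMon_mem_graded (coordinateGrading quadric) (coord_mem quadric) h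

/-- Forms of degree `n d`, divided by the `n`-th power of a form of degree `d`. -/
def awayMkHom {d : ℕ} {g : CurveRing} (hg : g ∈ coordinateGrading quadric d) (n : ℕ) :
    coordinateGrading quadric (n • d) →+ Away (coordinateGrading quadric) g where
  toFun a := Away.mk _ hg n a a.2
  map_zero' := by
    apply val_injective
    rw [Away.val_mk]
    simp [Localization.mk_zero]
  map_add' a b := by
    apply val_injective
    rw [val_add, Away.val_mk, Away.val_mk, Away.val_mk, Localization.add_mk_self]
    rfl

/-- An additive subgroup of the functions on `D₊(g)` is everything if it contains the fractions
with numerators `x₂ᵘ x₃ᵛ e_j`. -/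
lemma mem_of_normalMon_mem {d : ℕ} {g : CurveRing} (hg : g ∈ coordinateGrading quadric d)
    (H : AddSubgroup (Away (coordinateGrading quadric) g))
    (h : ∀ n u v j (e : u + v + normalDegree j = n • d),
      Away.mk _ hg n (normalMon (coord quadric) u v j) (normalMon_coord_mem e) ∈ H)
    (z : Away (coordinateGrading quadric) g) : z ∈ H := by
  obtain ⟨n, a, ha, rfl⟩ := Away.mk_surjective _ hg z
  let K : AddSubgroup CurveRing :=
    (H.comap (awayMkHom hg n)).map (coordinateGrading quadric (n • d)).subtype.toAddMonoidHom
  have : normalSpan (coord quadric) (n • d) ≤ AddSubgroup.toZModSubmodule 3 K := by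
    refine Submodule.span_le.mpr ?_
    rintro _ ⟨u, v, j, e, rfl⟩
    exact ⟨⟨_, normalMon_coord_mem e⟩, h n u v j e, rfl⟩
  obtain ⟨b, hb, hba⟩ := this (mem_normalSpan_of_mem_coordinateGrading ha)
  have : b = ⟨a, ha⟩ := Subtype.ext hba
  subst this
  exact hb

end Away

end GenusFive

/-! ### The Čech complex of the two charts -/

namespace GenusFive

open HomogeneousLocalization

attribute [local instance] MvPolynomial.gradedAlgebra

section Cech

/-- Restriction of functions from `x₂ ≠ 0` to `x₂x₃ ≠ 0`. -/
abbrev restrictLeft : Away (coordinateGrading quadric) (coord quadric 1) →+*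
    Away (coordinateGrading quadric) torusEquation :=
  awayMap (coordinateGrading quadric) (coord_mem quadric 2) rfl

/-- Restriction of functions from `x₃ ≠ 0` to `x₂x₃ ≠ 0`. -/
abbrev restrictRight : Away (coordinateGrading quadric) (coord quadric 2) →+*
    Away (coordinateGrading quadric) torusEquation :=
  awayMap (coordinateGrading quadric) (coord_mem quadric 1) (mul_comm _ _)

/-- The basis of `H¹(C, 𝒪)`: the triple `(j, a, b)` stands for the Čech cocycle `e_j / x₂ᵃ x₃ᵇ`. -/
def cechIndex : Fin 5 → Fin 8 × ℕ × ℕ := ![(4, 1, 1), (5, 1, 1), (6, 1, 1), (7, 2, 1), (7, 1, 2)]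

lemma cechIndex_degree (s : Fin 5) :
    1 ≤ (cechIndex s).2.1 ∧ (cechIndex s).2.1 ≤ 2 ∧ 1 ≤ (cechIndex s).2.2 ∧
      (cechIndex s).2.2 ≤ 2 ∧ normalDegree (cechIndex s).1 =
        (cechIndex s).2.1 + (cechIndex s).2.2 := by
  fin_cases s <;> decide

lemma exists_cechIndex {j : Fin 8} {a b : ℕ} (ha : 1 ≤ a) (hb : 1 ≤ b)
    (h : normalDegree j = a + b) : ∃ s, cechIndex s = (j, a, b) := by
  have hj : normalDegree j ≤ 3 := by fin_cases j <;> decide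
  have ha' : a ≤ 2 := by omega
  have hb' : b ≤ 2 := by omega
  interval_cases a <;> interval_cases b <;> revert h <;> revert j <;> decide

lemma cechIndex_injective {s s' : Fin 5} (h : (cechIndex s).1 = (cechIndex s').1)
    (h' : (cechIndex s).2.2 = (cechIndex s').2.2) : s = s' := by
  revert h h'
  revert s s'
  decide

lemma cechCocycle_degree (s : Fin 5) : 2 - (cechIndex s).2.1 + (2 - (cechIndex s).2.2) +
    normalDegree (cechIndex s).1 = 2 • 2 := by
  have := cechIndex_degree s
  rw [smul_eq_mul]
  omega

/-- The cocycle `e_j / x₂ᵃ x₃ᵇ`. -/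
def cechCocycle (s : Fin 5) : Away (coordinateGrading quadric) torusEquation :=
  Away.mk _ torusEquation_mem 2
    (normalMon (coord quadric) (2 - (cechIndex s).2.1) (2 - (cechIndex s).2.2) (cechIndex s).1)
    (normalMon_coord_mem (cechCocycle_degree s))

/-- The coefficients of `e_j / x₂ᵃ x₃ᵇ` in a function on `x₂x₃ ≠ 0`. -/
def cechClass : Away (coordinateGrading quadric) torusEquation →+ (Fin 5 → ZMod 3) where
  toFun z s := torusCoeff (-(cechIndex s).2.2) (cechIndex s).1 (torusFunction z)
  map_zero' := by ext; simp
  map_add' y z := by ext; simp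

lemma cechClass_mk (n : ℕ) {u v : ℕ} {j : Fin 8} (e : u + v + normalDegree j = n • 2) (s : Fin 5) :
    cechClass (Away.mk _ torusEquation_mem n (normalMon (coord quadric) u v j)
      (normalMon_coord_mem e)) s =
      if (v : ℤ) - n = -(cechIndex s).2.2 ∧ (cechIndex s).1 = j then 1 else 0 := by
  change torusCoeff _ _ (torusFunction _) = _
  rw [torusFunction_mk, restrictToTorus_normalMon, smul_smul, ← LaurentPolynomial.T_add,
    torusCoeff_smul, neg_add_eq_sub]

lemma cechClass_cechCocycle (s : Fin 5) : cechClass (cechCocycle s) = Pi.single s 1 := by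
  ext s'
  have h := cechIndex_degree s
  have h' := cechIndex_degree s'
  rw [cechCocycle, cechClass_mk _ (cechCocycle_degree s), Pi.single_apply]
  congr 1
  rw [eq_iff_iff]
  refine ⟨fun hs => cechIndex_injective hs.2 (by omega), ?_⟩
  rintro rfl
  exact ⟨by omega, rfl⟩

lemma restrictLeft_mk (n : ℕ) {u v : ℕ} {j : Fin 8} (e : u + v + normalDegree j = n • 1) :
    restrictLeft (Away.mk _ (coord_mem quadric 1) n (normalMon (coord quadric) u v j)
      (normalMon_coord_mem e)) =
    Away.mk _ torusEquation_mem n (normalMon (coord quadric) u (v + n) j)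
      (normalMon_coord_mem (by simp at e ⊢; omega)) := by
  rw [awayMap_mk]
  congr 1
  simp only [normalMon]
  ring

lemma restrictRight_mk (n : ℕ) {u v : ℕ} {j : Fin 8} (e : u + v + normalDegree j = n • 1) :
    restrictRight (Away.mk _ (coord_mem quadric 2) n (normalMon (coord quadric) u v j)
      (normalMon_coord_mem e)) =
    Away.mk _ torusEquation_mem n (normalMon (coord quadric) (u + n) v j)
      (normalMon_coord_mem (by simp at e ⊢; omega)) := by
  rw [awayMap_mk]
  congr 1
  simp only [normalMon]
  ring

lemma cechClass_restrictLeft (z : Away (coordinateGrading quadric) (coord quadric 1)) :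
    cechClass (restrictLeft z) = 0 := by
  refine mem_of_normalMon_mem (coord_mem quadric 1)
    (cechClass.comp restrictLeft.toAddMonoidHom).ker (fun n u v j e => ?_) z
  change cechClass (restrictLeft _) = 0
  ext s
  have := cechIndex_degree s
  rw [restrictLeft_mk n e, cechClass_mk n (by rw [smul_eq_mul] at e ⊢; omega),
    if_neg (by push_cast; omega)]
  rfl

lemma cechClass_restrictRight (z : Away (coordinateGrading quadric) (coord quadric 2)) :
    cechClass (restrictRight z) = 0 := by
  refine mem_of_normalMon_mem (coord_mem quadric 2)
    (cechClass.comp restrictRight.toAddMonoidHom).ker (fun n u v j e => ?_) z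
  change cechClass (restrictRight _) = 0
  ext s
  have := cechIndex_degree s
  rw [restrictRight_mk n e, cechClass_mk n (by rw [smul_eq_mul] at e ⊢; omega), if_neg]
  · rfl
  · rintro ⟨h, rfl⟩
    simp at e
    omega

/-- The constant functions. -/
def torusScalar : ZMod 3 →+* Away (coordinateGrading quadric) torusEquation :=
  (fromZeroRingHom _ _).comp (algebraMap (ZMod 3) (coordinateGrading quadric 0))

/-- The combination of cocycles with given coefficients. -/
def cechCombination : (Fin 5 → ZMod 3) →+ Away (coordinateGrading quadric) torusEquation where
  toFun c := ∑ s, torusScalar (c s) * cechCocycle s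
  map_zero' := Finset.sum_eq_zero fun s _ => by rw [Pi.zero_apply, map_zero, zero_mul]
  map_add' c c' := by
    rw [← Finset.sum_add_distrib]
    exact Finset.sum_congr rfl fun s _ => by rw [Pi.add_apply, map_add, add_mul]

lemma cechCombination_single (s : Fin 5) : cechCombination (Pi.single s 1) = cechCocycle s := by
  have h : cechCombination (Pi.single s 1) = ∑ s', torusScalar ((Pi.single s 1 : Fin 5 → ZMod 3) s')
    * cechCocycle s' := rfl
  rw [h, Finset.sum_eq_single s]
  · rw [Pi.single_eq_same, map_one, one_mul]
  · intro s' _ hs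
    rw [Pi.single_eq_of_ne hs, map_zero, zero_mul]
  · exact fun h => absurd (Finset.mem_univ _) h

lemma cechClass_cechCombination (c : Fin 5 → ZMod 3) : cechClass (cechCombination c) = c := by
  let f : (Fin 5 → ZMod 3) →ₗ[ZMod 3] (Fin 5 → ZMod 3) :=
    (cechClass.comp cechCombination).toZModLinearMap 3
  have : f = LinearMap.id := by
    refine LinearMap.pi_ext' fun s => LinearMap.ext_ring ?_
    change cechClass (cechCombination (Pi.single s 1)) = Pi.single s 1
    rw [cechCombination_single, cechClass_cechCocycle]
  exact LinearMap.congr_fun this c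

lemma cechClass_surjective : Function.Surjective cechClass :=
  fun c => ⟨_, cechClass_cechCombination c⟩

/-- The cokernel of the Čech complex of `C` is five-dimensional: of the functions
`x₂ᵘ x₃ᵛ e_j / (x₂x₃)ⁿ`, those with `v ≥ n` extend to `x₂ ≠ 0`, those with `u ≥ n` extend to
`x₃ ≠ 0`, and the remaining ones are the cocycles of `cechIndex`. -/
lemma exists_of_cechClass_eq_zero {z : Away (coordinateGrading quadric) torusEquation}
    (hz : cechClass z = 0) : ∃ a b, z = restrictLeft a + restrictRight b := by
  have hmem : z ∈ restrictLeft.toAddMonoidHom.range ⊔ restrictRight.toAddMonoidHom.range ⊔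
      cechCombination.range := by
    refine mem_of_normalMon_mem torusEquation_mem _ (fun n u v j e => ?_) z
    rw [smul_eq_mul] at e
    by_cases hv : n ≤ v
    · obtain ⟨v, rfl⟩ := Nat.exists_eq_add_of_le' hv
      refine AddSubgroup.mem_sup_left (AddSubgroup.mem_sup_left ?_)
      exact ⟨_, restrictLeft_mk n (by simp; omega)⟩
    by_cases hu : n ≤ u
    · obtain ⟨u, rfl⟩ := Nat.exists_eq_add_of_le' hu
      refine AddSubgroup.mem_sup_left (AddSubgroup.mem_sup_right ?_)
      exact ⟨_, restrictRight_mk n (by simp; omega)⟩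
    refine AddSubgroup.mem_sup_right ?_
    obtain ⟨s, hs⟩ := exists_cechIndex (j := j) (a := n - u) (b := n - v) (by omega) (by omega)
      (by omega)
    refine ⟨Pi.single s 1, ?_⟩
    rw [cechCombination_single, cechCocycle]
    have h2 := cechIndex_degree s
    apply val_injective
    rw [Away.val_mk, Away.val_mk, Localization.mk_eq_mk_iff, Localization.r_iff_exists]
    refine ⟨1, ?_⟩
    have e1 : n + (2 - (cechIndex s).2.1) = 2 + u := by rw [hs] at h2 ⊢; dsimp at h2 ⊢; omega
    have e2 : n + (2 - (cechIndex s).2.2) = 2 + v := by rw [hs] at h2 ⊢; dsimp at h2 ⊢; omega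
    have e3 : (cechIndex s).1 = j := by rw [hs]
    rw [e3]
    simp only [normalMon, torusEquation, OneMemClass.coe_one, one_mul]
    calc _ = coord quadric 1 ^ (n + (2 - (cechIndex s).2.1)) *
          coord quadric 2 ^ (n + (2 - (cechIndex s).2.2)) * normalBasis (coord quadric) j := by ring
      _ = coord quadric 1 ^ (2 + u) * coord quadric 2 ^ (2 + v) *
          normalBasis (coord quadric) j := by rw [e1, e2]
      _ = _ := by ring
  obtain ⟨y, hy, w, ⟨c, rfl⟩, rfl⟩ := AddSubgroup.mem_sup.mp hmem
  obtain ⟨_, ⟨a, rfl⟩, _, ⟨b, rfl⟩, rfl⟩ := AddSubgroup.mem_sup.mp hy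
  refine ⟨a, b, ?_⟩
  rw [map_add, map_add, cechClass_cechCombination] at hz
  have h1 : cechClass (restrictLeft.toAddMonoidHom a) = 0 := cechClass_restrictLeft a
  have h2 : cechClass (restrictRight.toAddMonoidHom b) = 0 := cechClass_restrictRight b
  rw [h1, h2, zero_add, zero_add] at hz
  rw [hz, map_zero, add_zero]
  rfl

end Cech

end GenusFive

/-! ### The first cohomology group and covers by two open subsets -/

namespace SheafCohomology

open TopologicalSpace Opposite Limits

section Injective

variable {X : TopCat.{u}}

/-- An injective sheaf of abelian groups is flasque: a section over `V` is a homomorphism from the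
free abelian sheaf on `V`, which is a subsheaf of the free abelian sheaf on any `U ⊇ V`. -/
lemma surjective_restrict_of_injective
    (I : Sheaf (Opens.grothendieckTopology X) AddCommGrpCat.{u}) [hI : Injective I]
    {V U : Opens X} (i : V ⟶ U) : Function.Surjective (I.obj.map i.op) := by
  intro a
  let adj := (AddCommGrpCat.adj.{u}.whiskerRight (Opens X)ᵒᵖ).comp
    (sheafificationAdjunction (Opens.grothendieckTopology X) AddCommGrpCat.{u})
  let e (W : Opens X) := (adj.homEquiv (yoneda.obj W) I).trans yonedaEquiv
  let j := (presheafToSheaf (Opens.grothendieckTopology X) AddCommGrpCat.{u}).map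
    (Functor.whiskerRight (yoneda.map i) AddCommGrpCat.free)
  have : Mono j := by
    dsimp only [j]
    infer_instance
  let g := Injective.factorThru ((e V).symm a) j
  have hg : j ≫ g = (e V).symm a := Injective.comp_factorThru _ _
  refine ⟨e U g, ?_⟩
  have h1 : e V (j ≫ g) = a := by rw [hg, Equiv.apply_symm_apply]
  have h2 : adj.homEquiv (yoneda.obj V) I (j ≫ g) =
      yoneda.map i ≫ adj.homEquiv (yoneda.obj U) I g := adj.homEquiv_naturality_left _ _
  rw [← h1]
  change _ = yonedaEquiv (adj.homEquiv (yoneda.obj V) I (j ≫ g))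
  rw [h2]
  exact yonedaEquiv_naturality (adj.homEquiv (yoneda.obj U) I g) i

end Injective

section Gluing

variable {X : TopCat.{u}} (F : Sheaf (Opens.grothendieckTopology X) AddCommGrpCat.{u})

/-- Restriction of sections of a sheaf. -/
abbrev res {V U : Opens X} (h : V ≤ U) : F.obj.obj (op U) →+ F.obj.obj (op V) :=
  (F.obj.map (homOfLE h).op).hom

lemma res_res {W V U : Opens X} (h : V ≤ U) (h' : W ≤ V) (s : F.obj.obj (op U)) :
    res F h' (res F h s) = res F (h'.trans h) s := by
  change (F.obj.map _ ≫ F.obj.map _).hom s = _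
  rw [← F.obj.map_comp]
  rfl

lemma res_self {U : Opens X} (h : U ≤ U) (s : F.obj.obj (op U)) : res F h s = s := by
  change (F.obj.map (𝟙 _)).hom s = _
  rw [F.obj.map_id]
  rfl

variable {F} in
lemma app_res {G : Sheaf (Opens.grothendieckTopology X) AddCommGrpCat.{u}} (f : F ⟶ G)
    {V U : Opens X} (h : V ≤ U) (s : F.obj.obj (op U)) :
    (f.hom.app (op V)).hom (res F h s) = res G h ((f.hom.app (op U)).hom s) := by
  change (F.obj.map _ ≫ f.hom.app _).hom s = _
  rw [f.hom.naturality]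
  rfl

lemma eq_of_res_eq {U V W : Opens X} (hU : U ≤ W) (hV : V ≤ W) (h : W ≤ U ⊔ V)
    {s t : F.obj.obj (op W)} (h1 : res F hU s = res F hU t) (h2 : res F hV s = res F hV t) :
    s = t :=
  TopCat.Sheaf.eq_of_locally_eq₂ (show TopCat.Sheaf AddCommGrpCat X from F) (homOfLE hU)
    (homOfLE hV) h s t h1 h2

lemma exists_glue {U V W : Opens X} (hU : U ≤ W) (hV : V ≤ W) (h : W ≤ U ⊔ V)
    (s : F.obj.obj (op U)) (t : F.obj.obj (op V))
    (hst : res F (inf_le_left : U ⊓ V ≤ U) s = res F (inf_le_right : U ⊓ V ≤ V) t) :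
    ∃ r, res F hU r = s ∧ res F hV r = t := by
  let f : Fin 2 → Opens X := ![U, V]
  let sf : (i : Fin 2) → F.obj.obj (op (f i))
    | 0 => s
    | 1 => t
  have hf (i : Fin 2) : f i ≤ W := by
    fin_cases i
    · exact hU
    · exact hV
  obtain ⟨r, hr, -⟩ := TopCat.Sheaf.existsUnique_gluing' (show TopCat.Sheaf AddCommGrpCat X from F)
    f W (fun i => homOfLE (hf i)) (h.trans (sup_le (le_iSup f 0) (le_iSup f 1))) sf (by
      simp only [TopCat.Presheaf.IsCompatible, Fin.forall_fin_two]
      refine ⟨⟨rfl, hst⟩, ?_, rfl⟩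
      have hst' := congrArg (res F (show V ⊓ U ≤ U ⊓ V from (inf_comm _ _).le)) hst
      rw [res_res, res_res] at hst'
      exact hst'.symm)
  exact ⟨r, hr 0, hr 1⟩

end Gluing

section MayerVietoris

variable {X : TopCat.{u}} (F : Sheaf (Opens.grothendieckTopology X) AddCommGrpCat.{u})

/-- An open subset `U` is acyclic for `F` if sections over `U` of a quotient by `F` lift. This is
the vanishing of `H¹(U, F)`, in a form that avoids cohomology on `U`. -/
def IsAcyclicOn (U : Opens X) : Prop :=
  ∀ ⦃G Q : Sheaf (Opens.grothendieckTopology X) AddCommGrpCat.{u}⦄ (f : F ⟶ G) (g : G ⟶ Q)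
    (w : f ≫ g = 0), (ShortComplex.mk f g w).ShortExact →
    Function.Surjective (g.hom.app (op U))

variable {F} in
lemma exists_section_of_shortExact
    {G Q : Sheaf (Opens.grothendieckTopology X) AddCommGrpCat.{u}} {f : F ⟶ G} {g : G ⟶ Q}
    {w : f ≫ g = 0} (hS : (ShortComplex.mk f g w).ShortExact) {U : Opens X}
    (s : G.obj.obj (op U)) (hs : (g.hom.app (op U)).hom s = 0) :
    ∃ t, (f.hom.app (op U)).hom t = s :=
  TopCat.Sheaf.sections_exact_of_left_exact (X := X) (S := ShortComplex.mk f g w) hS.exact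
    hS.mono_f s hs

variable {F} in
lemma injective_section_of_shortExact
    {G Q : Sheaf (Opens.grothendieckTopology X) AddCommGrpCat.{u}} {f : F ⟶ G} {g : G ⟶ Q}
    {w : f ≫ g = 0} (hS : (ShortComplex.mk f g w).ShortExact) (U : Opens X) :
    Function.Injective (f.hom.app (op U)).hom := by
  have := hS.mono_f
  have h : Mono ((sheafToPresheaf (Opens.grothendieckTopology X) AddCommGrpCat.{u}).map f) :=
    inferInstanceAs (Mono ((sheafToPresheaf _ _).map (ShortComplex.mk f g w).f))
  have h' : Mono (f.hom.app (op U)) := (NatTrans.mono_iff_mono_app f.hom).mp h (op U)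
  exact (AddCommGrpCat.mono_iff_injective _).mp h'

/-- The connecting homomorphism from global sections of the cokernel to `H¹`. -/
def connecting {G Q : Sheaf (Opens.grothendieckTopology X) AddCommGrpCat.{u}} {f : F ⟶ G}
    {g : G ⟶ Q} {w : f ≫ g = 0} (hS : (ShortComplex.mk f g w).ShortExact) :
    Q.obj.obj (op ⊤) →+ Sheaf.H.{u} F 1 :=
  (hS.extClass.postcomp _ (zero_add 1)).comp
    (Sheaf.H.equiv₀ Q (isTerminalTop : IsTerminal (⊤ : Opens X))).symm.toAddMonoidHom

lemma connecting_surjective {G Q : Sheaf (Opens.grothendieckTopology X) AddCommGrpCat.{u}}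
    {f : F ⟶ G} {g : G ⟶ Q} {w : f ≫ g = 0} (hS : (ShortComplex.mk f g w).ShortExact)
    [Injective G] : Function.Surjective (connecting F hS) := by
  intro x
  obtain ⟨y, hy⟩ := Abelian.Ext.covariant_sequence_exact₁ _ hS (n₁ := 1) x
    (Subsingleton.elim (α := Sheaf.H.{u} G 1) _ _) (zero_add 1)
  refine ⟨Sheaf.H.equiv₀ Q (isTerminalTop : IsTerminal (⊤ : Opens X)) y, ?_⟩
  rw [← hy]
  change Abelian.Ext.comp ((Sheaf.H.equiv₀ Q _).symm (Sheaf.H.equiv₀ Q _ y)) _ (zero_add 1) = _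
  rw [AddEquiv.symm_apply_apply]

lemma connecting_eq_zero_iff {G Q : Sheaf (Opens.grothendieckTopology X) AddCommGrpCat.{u}}
    {f : F ⟶ G} {g : G ⟶ Q} {w : f ≫ g = 0} (hS : (ShortComplex.mk f g w).ShortExact)
    (q : Q.obj.obj (op ⊤)) :
    connecting F hS q = 0 ↔ ∃ t, (g.hom.app (op ⊤)).hom t = q := by
  let hT : IsTerminal (⊤ : Opens X) := isTerminalTop
  constructor
  · intro hq
    obtain ⟨y, hy⟩ := Abelian.Ext.covariant_sequence_exact₃ _ hS
      ((Sheaf.H.equiv₀ Q hT).symm q) (zero_add 1) hq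
    refine ⟨Sheaf.H.equiv₀ G hT y, ?_⟩
    refine (Sheaf.H.equiv₀_naturality hT g y).trans ?_
    rw [Sheaf.H.map_apply]
    exact (congrArg (Sheaf.H.equiv₀ Q hT) hy).trans (AddEquiv.apply_symm_apply _ _)
  · rintro ⟨t, rfl⟩
    change Abelian.Ext.comp ((Sheaf.H.equiv₀ Q hT).symm _) hS.extClass (zero_add 1) = 0
    have h := Sheaf.H.equiv₀_symm_naturality hT g t
    rw [Sheaf.H.map_apply] at h
    have h' : (Sheaf.H.equiv₀ Q hT).symm ((g.hom.app (op ⊤)).hom t) =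
      ((Sheaf.H.equiv₀ G hT).symm t).comp (Abelian.Ext.mk₀ g) (add_zero 0) := h.symm
    rw [h', Abelian.Ext.comp_assoc_of_second_deg_zero]
    have h0 : (Abelian.Ext.mk₀ g).comp hS.extClass (zero_add 1) = 0 := hS.comp_extClass
    rw [h0, Abelian.Ext.comp_zero]

/-- For a cover by two acyclic open subsets, `H¹` is the first Čech cohomology group. Embed `F` into
an injective sheaf `I`. A class in `H¹` comes from a global section of `I / F`; lifts of it to `U`
and to `V` differ on `U ∩ V` by a section of `F`. The group of all such data maps onto both sides,
with the same kernel. -/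
theorem nonempty_H_one_addEquiv {U V : Opens X} (hUV : ⊤ ≤ U ⊔ V) (hU : IsAcyclicOn F U)
    (hV : IsAcyclicOn F V) {M : Type*} [AddCommGroup M] (φ : F.obj.obj (op (U ⊓ V)) →+ M)
    (hφ : Function.Surjective φ)
    (hker : ∀ c, φ c = 0 ↔ ∃ a b, c = res F inf_le_left a + res F inf_le_right b) :
    Nonempty (Sheaf.H.{u} F 1 ≃+ M) := by
  let I := Injective.under F
  let f : F ⟶ I := Injective.ι F
  let Q := cokernel f
  let g : I ⟶ Q := cokernel.π f
  let w : f ≫ g = 0 := cokernel.condition f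
  have hS : (ShortComplex.mk f g w).ShortExact :=
    { exact := ShortComplex.exact_cokernel f
      mono_f := inferInstanceAs (Mono (Injective.ι F))
      epi_g := inferInstanceAs (Epi (cokernel.π f)) }
  -- a global section of the cokernel together with lifts to `U` and `V` and their difference
  let P : AddSubgroup ((I.obj.obj (op U) × I.obj.obj (op V)) ×
      (F.obj.obj (op (U ⊓ V)) × Q.obj.obj (op ⊤))) :=
    { carrier := {p | (f.hom.app _).hom p.2.1 = res I inf_le_left p.1.1 - res I inf_le_right p.1.2 ∧
        (g.hom.app _).hom p.1.1 = res Q le_top p.2.2 ∧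
        (g.hom.app _).hom p.1.2 = res Q le_top p.2.2}
      zero_mem' := by simp
      add_mem' := by
        rintro a b ⟨ha, ha', ha''⟩ ⟨hb, hb', hb''⟩
        refine ⟨?_, ?_, ?_⟩
        · simp only [Prod.snd_add, Prod.fst_add, map_add, ha, hb]
          abel
        · simp only [Prod.snd_add, Prod.fst_add, map_add, ha', hb']
        · simp only [Prod.snd_add, Prod.fst_add, map_add, ha'', hb'']
      neg_mem' := by
        rintro a ⟨ha, ha', ha''⟩
        refine ⟨?_, ?_, ?_⟩
        · simp only [Prod.snd_neg, Prod.fst_neg, map_neg, ha]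
          abel
        · simp only [Prod.snd_neg, Prod.fst_neg, map_neg, ha']
        · simp only [Prod.snd_neg, Prod.fst_neg, map_neg, ha''] }
  let α : P →+ Sheaf.H.{u} F 1 := (connecting F hS).comp
    ((AddMonoidHom.snd _ _).comp ((AddMonoidHom.snd _ _).comp P.subtype))
  let β : P →+ M := φ.comp ((AddMonoidHom.fst _ _).comp ((AddMonoidHom.snd _ _).comp P.subtype))
  have hα : Function.Surjective α := by
    intro x
    obtain ⟨q, rfl⟩ := connecting_surjective F hS x
    obtain ⟨s, hs⟩ := hU f g w hS (res Q le_top q)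
    obtain ⟨t, ht⟩ := hV f g w hS (res Q le_top q)
    obtain ⟨c, hc⟩ := exists_section_of_shortExact hS
      (res I (inf_le_left : U ⊓ V ≤ U) s - res I (inf_le_right : U ⊓ V ≤ V) t) (by
        rw [map_sub, app_res, app_res]
        exact (congrArg₂ (fun x y => res Q _ x - res Q _ y) hs ht).trans (by
          rw [res_res, res_res, sub_self]))
    exact ⟨⟨((s, t), (c, q)), hc, hs, ht⟩, rfl⟩
  have hβ : Function.Surjective β := by
    intro m
    obtain ⟨c, rfl⟩ := hφ m
    obtain ⟨s, hs⟩ := surjective_restrict_of_injective I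
      (homOfLE (inf_le_left : U ⊓ V ≤ U)) ((f.hom.app _).hom c)
    have hs' : res I (inf_le_left : U ⊓ V ≤ U) s = (f.hom.app _).hom c := hs
    obtain ⟨q, hq, hq'⟩ := exists_glue Q le_top le_top hUV ((g.hom.app _).hom s) 0 (by
      rw [← app_res, hs', map_zero]
      change (f ≫ g).hom.app _ c = 0
      rw [w]
      rfl)
    refine ⟨⟨((s, 0), (c, q)), ?_, hq.symm, ?_⟩, rfl⟩
    · rw [hs', map_zero, sub_zero]
    · exact (map_zero _).trans hq'.symm
  have hαβ : α.ker = β.ker := by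
    ext ⟨⟨⟨s, t⟩, c, q⟩, hc, hs, ht⟩
    rw [AddMonoidHom.mem_ker, AddMonoidHom.mem_ker]
    change connecting F hS q = 0 ↔ φ c = 0
    rw [connecting_eq_zero_iff, hker]
    change (f.hom.app _).hom c = res I inf_le_left s - res I inf_le_right t at hc
    change (g.hom.app _).hom s = res Q le_top q at hs
    change (g.hom.app _).hom t = res Q le_top q at ht
    have hfg {W : Opens X} (x : F.obj.obj (op W)) :
        (g.hom.app _).hom ((f.hom.app _).hom x) = 0 := by
      change (f ≫ g).hom.app _ x = 0
      rw [w]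
      rfl
    constructor
    · rintro ⟨r, rfl⟩
      rw [← app_res] at hs ht
      obtain ⟨a, ha⟩ := exists_section_of_shortExact hS (s - res I le_top r) (by
        rw [map_sub, hs, sub_self])
      obtain ⟨b, hb⟩ := exists_section_of_shortExact hS (t - res I le_top r) (by
        rw [map_sub, ht, sub_self])
      refine ⟨a, -b, injective_section_of_shortExact hS _ ?_⟩
      rw [hc, map_neg, map_add, map_neg, app_res, app_res, ha, hb, map_sub, map_sub, res_res,
        res_res]
      abel
    · rintro ⟨a, b, rfl⟩
      rw [map_add, app_res, app_res] at hc
      obtain ⟨r, hr, hr'⟩ := exists_glue I le_top le_top hUV (s - (f.hom.app _).hom a)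
        (t + (f.hom.app _).hom b) (by
          rw [map_sub, map_add, sub_eq_iff_eq_add, add_assoc, add_comm (res I _ _) (res I _ _), hc]
          abel)
      refine ⟨r, eq_of_res_eq Q le_top le_top hUV ?_ ?_⟩
      · rw [← app_res, hr, map_sub, hs, hfg, sub_zero]
      · rw [← app_res, hr', map_add, ht, hfg, add_zero]
  exact ⟨(QuotientAddGroup.quotientKerEquivOfSurjective α hα).symm.trans
    ((QuotientAddGroup.quotientAddEquivOfEq hαβ).trans
      (QuotientAddGroup.quotientKerEquivOfSurjective β hβ))⟩

end MayerVietoris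

end SheafCohomology

/-! ### Acyclicity of affine open subsets -/

namespace SheafCohomology

open TopologicalSpace Opposite Limits

/-- If `a` and `b` generate the unit ideal, a fraction with denominator `(ab)ⁿ` is the difference
of fractions with denominators `aⁿ` and `bⁿ`. -/
lemma exists_eq_sub_of_isCoprime {R A B D : Type*} [CommRing R] [CommRing A] [CommRing B]
    [CommRing D] (rA : R →+* A) (rB : R →+* B) (α : A →+* D) (β : B →+* D)
    (h : ∀ r, α (rA r) = β (rB r)) {a b : R} (hab : IsCoprime a b) (ha : IsUnit (rA a))
    (hb : IsUnit (rB b)) {c : D} {n : ℕ} {r : R} (hc : c * α (rA (a * b)) ^ n = α (rA r)) :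
    ∃ s t, c = α s - β t := by
  obtain ⟨u, v, huv⟩ : IsCoprime (a ^ n) (b ^ n) := hab.pow
  obtain ⟨a', ha'⟩ := ha.exists_right_inv
  obtain ⟨b', hb'⟩ := hb.exists_right_inv
  have h1 : α (rA a) * α a' = 1 := by rw [← map_mul, ha', map_one]
  have h2 : α (rA b) * β b' = 1 := by rw [h, ← map_mul, hb', map_one]
  refine ⟨rA (v * r) * a' ^ n, -(rB (u * r) * b' ^ n), ?_⟩
  have huv' := congrArg (fun x => α (rA x)) huv
  simp only [map_add, map_mul, map_pow, map_one, map_neg, sub_neg_eq_add, ← h] at huv' hc ⊢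
  have h1' : α (rA a) ^ n * α a' ^ n = 1 := by rw [← mul_pow, h1, one_pow]
  have h2' : α (rA b) ^ n * β b' ^ n = 1 := by rw [← mul_pow, h2, one_pow]
  have hc' : c = α (rA r) * α a' ^ n * β b' ^ n := by
    rw [← hc, mul_pow]
    linear_combination (-c) * h1' - c * (α (rA a) ^ n * α a' ^ n) * h2'
  rw [hc']
  linear_combination (-α (rA r) * α a' ^ n * β b' ^ n) * huv' +
    (α (rA u) * α (rA r) * β b' ^ n) * h1' + (α (rA v) * α (rA r) * α a' ^ n) * h2'

section Affine

variable {X : Scheme.{u}}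

lemma exists_eq_res_sub_res {W : X.Opens} (hW : IsAffineOpen W) {a b : Γ(X, W)}
    (hab : IsCoprime a b) (c : Γ(X, X.basicOpen a ⊓ X.basicOpen b)) :
    ∃ (s : Γ(X, X.basicOpen a)) (t : Γ(X, X.basicOpen b)),
      c = X.presheaf.map (homOfLE inf_le_left).op s -
        X.presheaf.map (homOfLE inf_le_right).op t := by
  let i : X.basicOpen a ⊓ X.basicOpen b ⟶ W := homOfLE (inf_le_left.trans (X.basicOpen_le a))
  have hc := hW.isLocalization_of_eq_basicOpen (a * b) i (X.basicOpen_mul a b).symm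
  let := (X.presheaf.map i.op).hom.toAlgebra
  obtain ⟨n, r, hr⟩ := IsLocalization.Away.surj (a * b) c
  have hi (r : Γ(X, W)) : X.presheaf.map (homOfLE inf_le_left).op
      (X.presheaf.map (homOfLE (X.basicOpen_le a)).op r) = X.presheaf.map i.op r := by
    rw [← CommRingCat.comp_apply, ← X.presheaf.map_comp]
    rfl
  refine exists_eq_sub_of_isCoprime (X.presheaf.map (homOfLE (X.basicOpen_le a)).op).hom
    (X.presheaf.map (homOfLE (X.basicOpen_le b)).op).hom
    (X.presheaf.map (homOfLE inf_le_left).op).hom (X.presheaf.map (homOfLE inf_le_right).op).hom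
    ?_ hab (RingedSpace.isUnit_res_basicOpen _ a) (RingedSpace.isUnit_res_basicOpen _ b)
    (c := c) (n := n) (r := r) ?_
  · intro r
    refine (hi r).trans ?_
    change _ = X.presheaf.map _ (X.presheaf.map _ r)
    rw [← CommRingCat.comp_apply, ← X.presheaf.map_comp]
    rfl
  · refine Eq.trans ?_ (hr.trans (hi r).symm)
    exact congrArg (fun x => c * x ^ n) (hi (a * b))

variable {G Q : Sheaf (Opens.grothendieckTopology X) AddCommGrpCat.{u}}
    {f : GenusFive.additiveStructureSheaf X ⟶ G} {g : G ⟶ Q} {w : f ≫ g = 0}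
    (hS : (ShortComplex.mk f g w).ShortExact)

include hS

/-- Lifts over `D(a)` and `D(b)` can be corrected to agree on `D(ab)`, if `a` and `b` generate the
unit ideal. -/
lemma lift_of_isCoprime {W : X.Opens} (hW : IsAffineOpen W) {a b : Γ(X, W)}
    (hab : IsCoprime a b) (q : Q.obj.obj (op W))
    (ha : ∃ s, (g.hom.app _).hom s = res Q (X.basicOpen_le a) q)
    (hb : ∃ s, (g.hom.app _).hom s = res Q (X.basicOpen_le b) q) :
    ∃ s, (g.hom.app _).hom s = q := by
  obtain ⟨s, hs⟩ := ha
  obtain ⟨t, ht⟩ := hb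
  have hcov : W ≤ X.basicOpen a ⊔ X.basicOpen b := by
    obtain ⟨u, v, huv⟩ := hab
    have h := X.basicOpen_add_le (u * a) (v * b)
    rw [huv, X.basicOpen_mul, X.basicOpen_mul] at h
    exact (X.basicOpen_one (U := W)).ge.trans (h.trans (sup_le_sup inf_le_right inf_le_right))
  obtain ⟨c, hc⟩ := exists_section_of_shortExact hS
      (res G (inf_le_left : X.basicOpen a ⊓ X.basicOpen b ≤ _) s - res G inf_le_right t) (by
        rw [map_sub, app_res, app_res, hs, ht, res_res, res_res, sub_self])
  obtain ⟨c₁, c₂, h⟩ :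
      ∃ (c₁ : (GenusFive.additiveStructureSheaf X).obj.obj (op (X.basicOpen a)))
        (c₂ : (GenusFive.additiveStructureSheaf X).obj.obj (op (X.basicOpen b))),
      c = res (GenusFive.additiveStructureSheaf X) inf_le_left c₁ -
        res (GenusFive.additiveStructureSheaf X) inf_le_right c₂ :=
    exists_eq_res_sub_res hW hab c
  rw [h, map_sub, app_res, app_res] at hc
  have hfg {W : X.Opens} (x : (GenusFive.additiveStructureSheaf X).obj.obj (op W)) :
      (g.hom.app (op W)).hom ((f.hom.app (op W)).hom x) = 0 := by
    change (f ≫ g).hom.app _ x = 0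
    rw [w]
    rfl
  obtain ⟨r, hr, hr'⟩ := exists_glue G (X.basicOpen_le a) (X.basicOpen_le b) hcov
    (s - (f.hom.app _).hom c₁) (t - (f.hom.app _).hom c₂) (by
      rw [map_sub, map_sub, sub_eq_sub_iff_sub_eq_sub]
      exact hc.symm)
  refine ⟨r, eq_of_res_eq Q (X.basicOpen_le a) (X.basicOpen_le b) hcov ?_ ?_⟩
  · rw [← app_res, hr, map_sub, hs, hfg, sub_zero]
  · rw [← app_res, hr', map_sub, ht, hfg, sub_zero]

omit hS in
lemma exists_lift_mono {V W : X.Opens} (h : V ≤ W) {U : X.Opens} (hWU : W ≤ U)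
    {q : Q.obj.obj (op U)} (hq : ∃ s, (g.hom.app _).hom s = res Q hWU q) :
    ∃ s, (g.hom.app _).hom s = res Q (h.trans hWU) q := by
  obtain ⟨s, hs⟩ := hq
  exact ⟨res G h s, by rw [app_res, hs, res_res]⟩

/-- The functions `a` such that a given section of the quotient lifts over `D(a)` form an ideal:
over `D(a + b)` the functions `a` and `b` generate the unit ideal. -/
def liftIdeal {G Q : Sheaf (Opens.grothendieckTopology X) AddCommGrpCat.{u}}
    {f : GenusFive.additiveStructureSheaf X ⟶ G} {g : G ⟶ Q} {w : f ≫ g = 0}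
    (hS : (ShortComplex.mk f g w).ShortExact) {U : X.Opens} (hU : IsAffineOpen U)
    (q : Q.obj.obj (op U)) : Ideal Γ(X, U) where
  carrier := {a | ∃ s, (g.hom.app _).hom s = res Q (X.basicOpen_le a) q}
  zero_mem' := by
    refine ⟨0, TopCat.Sheaf.eq_of_locally_eq' (show TopCat.Sheaf AddCommGrpCat X from Q)
      (fun i : PEmpty.{1} => i.elim) _ (fun i => i.elim) ?_ _ _ fun i => i.elim⟩
    rw [X.basicOpen_zero]
    exact bot_le
  add_mem' := by
    intro a b ha hb
    let i : X.basicOpen (a + b) ⟶ U := homOfLE (X.basicOpen_le _)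
    have hle (c : Γ(X, U)) : X.basicOpen (X.presheaf.map i.op c) ≤ X.basicOpen c := by
      rw [X.basicOpen_res]
      exact inf_le_right
    have hu : IsUnit (X.presheaf.map i.op a + X.presheaf.map i.op b) := by
      rw [← map_add]
      exact RingedSpace.isUnit_res_basicOpen _ (a + b)
    have hab : IsCoprime (X.presheaf.map i.op a) (X.presheaf.map i.op b) := by
      obtain ⟨v, hv⟩ := hu.exists_left_inv
      exact ⟨v, v, by rw [← mul_add, hv]⟩
    refine lift_of_isCoprime hS (hU.basicOpen (a + b)) hab _ ?_ ?_
    · rw [res_res]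
      exact exists_lift_mono (hle a) (X.basicOpen_le a) ha
    · rw [res_res]
      exact exists_lift_mono (hle b) (X.basicOpen_le b) hb
  smul_mem' := by
    intro a b hb
    have h : X.basicOpen (a • b) ≤ X.basicOpen b := by
      rw [smul_eq_mul, X.basicOpen_mul]
      exact inf_le_right
    exact exists_lift_mono h (X.basicOpen_le b) hb

omit hS in
/-- Affine open subsets are acyclic for the structure sheaf: the functions `a` such that a section
lifts over `D(a)` form an ideal, and the open subsets `D(a)` cover. -/
theorem isAcyclicOn_of_isAffineOpen {U : X.Opens} (hU : IsAffineOpen U) :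
    IsAcyclicOn (GenusFive.additiveStructureSheaf X) U := by
  intro G Q f g w hS q
  have hlift : ∀ x ∈ U, ∃ a ∈ liftIdeal hS hU q, x ∈ X.basicOpen a := by
    intro x hx
    have hepi : Epi g := hS.epi_g
    obtain ⟨V, hV, ⟨s, hs⟩, hxV⟩ := (TopCat.Presheaf.isLocallySurjective_iff g.hom).mp
      ((TopCat.Sheaf.isLocallySurjective_iff_epi (X := X) g).mpr hepi) U q x hx
    obtain ⟨a, haV, hxa⟩ := hU.exists_basicOpen_le ⟨x, hxV⟩ hx
    have hs' : (g.hom.app (op V)).hom s = res Q hV q := hs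
    exact ⟨a, exists_lift_mono haV hV ⟨s, hs'⟩, hxa⟩
  have htop : liftIdeal hS hU q = ⊤ := by
    rw [← Ideal.span_eq (liftIdeal hS hU q), ← hU.self_le_iSup_basicOpen_iff]
    intro x hx
    obtain ⟨a, ha, hxa⟩ := hlift x hx
    exact Opens.mem_iSup.mpr ⟨⟨a, ha⟩, hxa⟩
  obtain ⟨s, hs⟩ := exists_lift_mono (X.basicOpen_one (U := U)).ge (X.basicOpen_le _)
    ((Ideal.eq_top_iff_one _).mp htop)
  exact ⟨s, hs.trans (res_self Q _ q)⟩

end Affine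

end SheafCohomology

/-! ### The genus -/

namespace GenusFive

open HomogeneousLocalization SheafCohomology Opposite

attribute [local instance] MvPolynomial.gradedAlgebra

section Sections

variable {A σ : Type u} [CommRing A] [SetLike σ A] [AddSubgroupClass σ A] (𝒜 : ℕ → σ)
  [GradedRing 𝒜]

/-- The sections of the structure sheaf on a basic open subset. -/
def projSectionEquiv {d : ℕ} {g : A} (hg : g ∈ 𝒜 d) (hd : 0 < d) :
    Away 𝒜 g ≃+* Γ(Proj 𝒜, Proj.basicOpen 𝒜 g) :=
  (Proj.basicOpenIsoAway 𝒜 g hg hd).commRingCatIsoToRingEquiv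

lemma projSectionEquiv_apply {d : ℕ} {g : A} (hg : g ∈ 𝒜 d) (hd : 0 < d) (a : Away 𝒜 g) :
    projSectionEquiv 𝒜 hg hd a = (Proj.awayToSection 𝒜 g).hom a := rfl

lemma projSectionEquiv_awayMap {d e c : ℕ} {f g x : A} (hf : f ∈ 𝒜 d) (hd : 0 < d)
    (hg : g ∈ 𝒜 e) (hx : x = f * g) (hxc : x ∈ 𝒜 c) (hc : 0 < c)
    (h : Proj.basicOpen 𝒜 x ≤ Proj.basicOpen 𝒜 f) (a : Away 𝒜 f) :
    projSectionEquiv 𝒜 hxc hc (awayMap 𝒜 hg hx a) =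
      (Proj 𝒜).presheaf.map (homOfLE h).op (projSectionEquiv 𝒜 hf hd a) := by
  rw [projSectionEquiv_apply, projSectionEquiv_apply]
  have h := congrArg (fun f => f.hom a) (Proj.awayMap_awayToSection 𝒜 hg hx)
  simp only [CommRingCat.hom_comp, CommRingCat.hom_ofHom, RingHom.comp_apply] at h
  exact h

end Sections

section Genus

/-- The curve `C` as `Proj` of its homogeneous coordinate ring. -/
abbrev curve : Scheme.{0} := Proj (coordinateGrading quadric)

/-- The open subset `x₂ ≠ 0` of `C`. -/
abbrev leftOpen : curve.Opens := Proj.basicOpen (coordinateGrading quadric) (coord quadric 1)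

/-- The open subset `x₃ ≠ 0` of `C`. -/
abbrev rightOpen : curve.Opens := Proj.basicOpen (coordinateGrading quadric) (coord quadric 2)

/-- The open subset `x₂x₃ ≠ 0` of `C`. -/
abbrev torusOpen : curve.Opens := Proj.basicOpen (coordinateGrading quadric) torusEquation

lemma torusOpen_eq : torusOpen = leftOpen ⊓ rightOpen :=
  Proj.basicOpen_mul _ _ _

/-- The sections of the structure sheaf on a basic open subset. -/
abbrev sectionEquiv {d : ℕ} {g : CurveRing} (hg : g ∈ coordinateGrading quadric d) (hd : 0 < d) :
    Away (coordinateGrading quadric) g ≃+* Γ(curve, Proj.basicOpen _ g) :=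
  projSectionEquiv (coordinateGrading quadric) hg hd

lemma sectionEquiv_restrictLeft (a : Away (coordinateGrading quadric) (coord quadric 1)) :
    sectionEquiv torusEquation_mem two_pos (restrictLeft a) =
      curve.presheaf.map (homOfLE (torusOpen_eq.le.trans inf_le_left)).op
        (sectionEquiv (coord_mem quadric 1) one_pos a) :=
  projSectionEquiv_awayMap (coordinateGrading quadric) (coord_mem quadric 1) one_pos
    (coord_mem quadric 2) rfl torusEquation_mem two_pos _ a

lemma sectionEquiv_restrictRight (a : Away (coordinateGrading quadric) (coord quadric 2)) :
    sectionEquiv torusEquation_mem two_pos (restrictRight a) =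
      curve.presheaf.map (homOfLE (torusOpen_eq.le.trans inf_le_right)).op
        (sectionEquiv (coord_mem quadric 2) one_pos a) :=
  projSectionEquiv_awayMap (coordinateGrading quadric) (coord_mem quadric 2) one_pos
    (coord_mem quadric 1) (mul_comm _ _) torusEquation_mem two_pos _ a

/-- The class in the cokernel of the Čech complex of a function on `x₂x₃ ≠ 0`. -/
def sectionClass : Γ(curve, leftOpen ⊓ rightOpen) →+ (Fin 5 → ZMod 3) :=
  (cechClass.comp (sectionEquiv torusEquation_mem two_pos).symm.toAddMonoidHom).comp
    (curve.presheaf.map (homOfLE torusOpen_eq.le).op).hom.toAddMonoidHom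

lemma exists_sectionClass (z : Away (coordinateGrading quadric) torusEquation) :
    ∃ c : Γ(curve, leftOpen ⊓ rightOpen),
      curve.presheaf.map (homOfLE torusOpen_eq.le).op c =
        sectionEquiv torusEquation_mem two_pos z := by
  refine ⟨curve.presheaf.map (homOfLE torusOpen_eq.ge).op
    (sectionEquiv torusEquation_mem two_pos z), ?_⟩
  rw [← CommRingCat.comp_apply, ← curve.presheaf.map_comp]
  exact ConcreteCategory.congr_hom (curve.presheaf.map_id _) _

lemma restrict_torusOpen_injective : Function.Injective
    (curve.presheaf.map (homOfLE torusOpen_eq.le).op) := by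
  refine Function.LeftInverse.injective (g := curve.presheaf.map (homOfLE torusOpen_eq.ge).op) ?_
  intro c
  rw [← CommRingCat.comp_apply, ← curve.presheaf.map_comp]
  exact ConcreteCategory.congr_hom (curve.presheaf.map_id _) _

lemma sectionClass_eq {c : Γ(curve, leftOpen ⊓ rightOpen)}
    {z : Away (coordinateGrading quadric) torusEquation}
    (h : curve.presheaf.map (homOfLE torusOpen_eq.le).op c =
      sectionEquiv torusEquation_mem two_pos z) : sectionClass c = cechClass z := by
  change cechClass ((sectionEquiv torusEquation_mem two_pos).symm (curve.presheaf.map _ c)) = _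
  rw [h, RingEquiv.symm_apply_apply]

lemma sectionClass_surjective : Function.Surjective sectionClass := by
  intro v
  obtain ⟨z, rfl⟩ := cechClass_surjective v
  obtain ⟨c, hc⟩ := exists_sectionClass z
  exact ⟨c, sectionClass_eq hc⟩

lemma sectionClass_eq_zero_iff (c : Γ(curve, leftOpen ⊓ rightOpen)) :
    sectionClass c = 0 ↔ ∃ (a : Γ(curve, leftOpen)) (b : Γ(curve, rightOpen)),
      c = curve.presheaf.map (homOfLE inf_le_left).op a +
        curve.presheaf.map (homOfLE inf_le_right).op b := by
  have hres {W : curve.Opens} (h : leftOpen ⊓ rightOpen ≤ W) (a : Γ(curve, W)) :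
      curve.presheaf.map (homOfLE torusOpen_eq.le).op (curve.presheaf.map (homOfLE h).op a) =
        curve.presheaf.map (homOfLE (torusOpen_eq.le.trans h)).op a := by
    rw [← CommRingCat.comp_apply, ← curve.presheaf.map_comp]
    rfl
  obtain ⟨z, hz⟩ := (sectionEquiv torusEquation_mem two_pos).surjective
    (curve.presheaf.map (homOfLE torusOpen_eq.le).op c)
  rw [sectionClass_eq hz.symm]
  constructor
  · intro h
    obtain ⟨a, b, rfl⟩ := exists_of_cechClass_eq_zero h
    refine ⟨sectionEquiv (coord_mem quadric 1) one_pos a,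
      sectionEquiv (coord_mem quadric 2) one_pos b, restrict_torusOpen_injective ?_⟩
    rw [← hz, map_add, map_add, sectionEquiv_restrictLeft, sectionEquiv_restrictRight, hres, hres]
  · rintro ⟨a, b, rfl⟩
    obtain ⟨a, rfl⟩ := (sectionEquiv (coord_mem quadric 1) one_pos).surjective a
    obtain ⟨b, rfl⟩ := (sectionEquiv (coord_mem quadric 2) one_pos).surjective b
    have : z = restrictLeft a + restrictRight b := by
      apply (sectionEquiv torusEquation_mem two_pos).injective
      rw [hz, map_add, map_add, sectionEquiv_restrictLeft, sectionEquiv_restrictRight, hres, hres]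
    rw [this, map_add, cechClass_restrictLeft, cechClass_restrictRight, add_zero]

lemma nonempty_structureCohomology_addEquiv :
    Nonempty (structureCohomology curve 1 ≃+ (Fin 5 → ZMod 3)) :=
  nonempty_H_one_addEquiv (additiveStructureSheaf curve) (U := leftOpen) (V := rightOpen)
    (fun x _ => mem_basicOpen_or x)
    (isAcyclicOn_of_isAffineOpen (Proj.isAffineOpen_basicOpen _ _ (coord_mem quadric 1) one_pos))
    (isAcyclicOn_of_isAffineOpen (Proj.isAffineOpen_basicOpen _ _ (coord_mem quadric 2) one_pos))
    sectionClass sectionClass_surjective sectionClass_eq_zero_iff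

/-- The first cohomology is five-dimensional. Its additive isomorphism with `𝔽₃⁵` is automatically
linear over the prime field. -/
theorem hasGenus_curve : HasGenus (projStructure (coordinateGrading quadric)) 5 := by
  obtain ⟨e⟩ := nonempty_structureCohomology_addEquiv
  let := structureCohomologyModule (projStructure (coordinateGrading quadric)) 1
  let e' : structureCohomology curve 1 ≃ₗ[ZMod 3] (Fin 5 → ZMod 3) :=
    LinearEquiv.ofBijective (e.toAddMonoidHom.toZModLinearMap 3) e.bijective
  change Module.rank (ZMod 3) (structureCohomology curve 1) = 5
  rw [e'.rank_eq, rank_fin_fun]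
  rfl

end Genus

end GenusFive

/-! ### Geometric irreducibility -/

namespace GenusFive

attribute [local instance] MvPolynomial.gradedAlgebra

section DenseChart

open Limits TensorProduct

/-- A scheme over a field with a dense affine open subscheme whose coordinate ring stays a domain
after every extension of the base field is geometrically irreducible: the base change to an
extension is an open map, so the preimage of the dense open subscheme stays dense. -/
lemma geometricallyIrreducible_of_dense {k B : Type u} [Field k] [CommRing B] [Algebra k B]
    {X : Scheme.{u}} (f : X ⟶ Spec (.of k)) (j : Spec (.of B) ⟶ X) [IsOpenImmersion j]
    (hj : j ≫ f = Spec.map (CommRingCat.ofHom (algebraMap k B))) (hd : DenseRange j)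
    (hB : ∀ (K : Type u) [Field K] [Algebra k K], IsDomain (B ⊗[k] K)) :
    GeometricallyIrreducible f := by
  refine ⟨geometrically_iff_of_commRing_of_isClosedUnderIsomorphisms.mpr fun K _ _ => ?_⟩
  have := hB K
  set g : Spec (.of K) ⟶ Spec (.of k) := Spec.map (CommRingCat.ofHom (algebraMap k K))
  have hU : IrreducibleSpace (pullback j (pullback.fst f g) : Scheme) := by
    rw [(pullbackRightPullbackFstIso f g j ≪≫ pullback.congrHom hj rfl ≪≫
      pullbackSpecIso k B K).hom.homeomorph.irreducibleSpace_iff]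
    exact PrimeSpectrum.irreducibleSpace
  have hopen : IsOpenMap (pullback.fst f g) := (pullback.fst f g).isOpenMap
  have hr : Set.range (pullback.snd j (pullback.fst f g)) = pullback.fst f g ⁻¹' Set.range j :=
    IsOpenImmersion.range_pullbackSnd _ _
  have hD : DenseRange (pullback.snd j (pullback.fst f g)) := by
    rw [DenseRange, hr]
    exact Dense.preimage hd hopen
  have hI := ((IrreducibleSpace.isIrreducible_univ _).image _
    (pullback.snd j (pullback.fst f g)).continuous.continuousOn).closure
  rw [Set.image_univ, hD.closure_range] at hI
  exact (irreducibleSpace_def _).mpr hI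

variable {A σ : Type u} [CommRing A] [SetLike σ A] [AddSubgroupClass σ A] (𝒜 : ℕ → σ)
  [GradedRing 𝒜]

/-- The sections over `D₊(g)` form the ring `A_(g)`, which is zero if `D₊(g)` is empty. -/
lemma isNilpotent_of_basicOpen_eq_bot {d : ℕ} {g : A} (hg : g ∈ 𝒜 d) (hd : 0 < d)
    (h : Proj.basicOpen 𝒜 g = ⊥) : IsNilpotent g := by
  have h1 : Subsingleton Γ(Proj 𝒜, Proj.basicOpen 𝒜 g) := by
    rw [h]
    infer_instance
  have h2 : (1 : HomogeneousLocalization.Away 𝒜 g) = 0 :=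
    (projSectionEquiv 𝒜 hg hd).injective (Subsingleton.elim _ _)
  have h3 := congrArg HomogeneousLocalization.val h2
  rw [HomogeneousLocalization.val_one, HomogeneousLocalization.val_zero,
    ← Localization.mk_one, Localization.mk_eq_mk', IsLocalization.mk'_eq_zero_iff] at h3
  obtain ⟨⟨_, n, rfl⟩, hn⟩ := h3
  exact ⟨n, by simpa using hn⟩

/-- If multiplication by `x` is injective on homogeneous elements, then `D₊(x)` is dense. -/
lemma dense_basicOpen {x : A} (hx : x ∈ 𝒜 1)
    (h : ∀ n, ∀ a ∈ 𝒜 n, x * a = 0 → a = 0) :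
    Dense (Proj.basicOpen 𝒜 x : Set (Proj 𝒜)) := by
  rw [dense_iff_inter_open]
  rintro U hU ⟨y, hy⟩
  obtain ⟨_, ⟨g, rfl⟩, hyg, hgU⟩ := TopologicalSpace.Opens.isBasis_iff_nbhd.mp
    (Proj.isBasis_basicOpen 𝒜) (U := ⟨U, hU⟩) hy
  rw [Proj.basicOpen_eq_iSup_proj, TopologicalSpace.Opens.mem_iSup] at hyg
  obtain ⟨n, hyn⟩ := hyg
  have hsub : Proj.basicOpen 𝒜 (GradedRing.proj 𝒜 n g) ≤ ⟨U, hU⟩ :=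
    ((le_iSup (fun i => Proj.basicOpen 𝒜 (GradedRing.proj 𝒜 i g)) n).trans
      (Proj.basicOpen_eq_iSup_proj 𝒜 g).ge).trans hgU
  set a := GradedRing.proj 𝒜 n g
  have ha : a ∈ 𝒜 n := SetLike.coe_mem _
  by_contra hemp
  have hbot : Proj.basicOpen 𝒜 (x * a) = ⊥ := by
    rw [Proj.basicOpen_mul, eq_bot_iff]
    exact fun z hz => hemp ⟨z, hsub hz.2, hz.1⟩
  obtain ⟨l, hl⟩ := isNilpotent_of_basicOpen_eq_bot 𝒜 (SetLike.mul_mem_graded hx ha)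
    (by omega) hbot
  have hcancel (m : ℕ) (h0 : x ^ m * a ^ l = 0) : a ^ l = 0 := by
    induction m with
    | zero => simpa using h0
    | succ m ih =>
      refine ih (h _ _ (SetLike.mul_mem_graded (SetLike.pow_mem_graded m hx)
        (SetLike.pow_mem_graded l ha)) ?_)
      rw [← mul_assoc, ← pow_succ', h0]
  have h0 : a ^ l = 0 := hcancel l (by rw [← mul_pow, hl])
  refine (Proj.mem_basicOpen 𝒜 a y).mp hyn ?_
  refine y.isPrime.mem_of_pow_mem l ?_
  rw [h0]
  exact zero_mem _

end DenseChart

/-- The chart `x₂ ≠ 0` is geometrically integral, and it is dense because `x₂` is not a zero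
divisor. -/
theorem geometricallyIrreducible_curve :
    GeometricallyIrreducible (projStructure (coordinateGrading quadric)) := by
  have := isOpenImmersion_chartMap quadric quadric_isHomogeneous 1
  refine geometricallyIrreducible_of_dense _ (chartMap quadric 1) (chartMap_structure quadric 1)
    ?_ fun K _ _ => isDomain_chart_tensor K
  rw [DenseRange, range_chartMap quadric quadric_isHomogeneous 1]
  exact dense_basicOpen _ (coord_mem quadric 1) fun n a ha h => eq_zero_of_coord_one_mul ha h

end GenusFive

/-! ### Smoothness -/

namespace GenusFive

attribute [local instance] MvPolynomial.gradedAlgebra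

section JacobianCriterion

open MvPolynomial

variable {R : Type u} [CommRing R] {σ ι : Type} [Fintype σ] [Fintype ι] [DecidableEq ι]

/-- The maximal minor of the Jacobian matrix of `v` with respect to the variables `a i`. -/
def jacobianMinor (v : ι → MvPolynomial σ R) (a : ι → σ) : MvPolynomial σ R :=
  Matrix.det (Matrix.of fun i j => pderiv (a i) (v j))

omit [Fintype σ] in
lemma jacobian_naive (v : ι → MvPolynomial σ R) {a : ι → σ} (ha : Function.Injective a) :
    (Algebra.PreSubmersivePresentation.naive (v := v) a ha).jacobian =
      Ideal.Quotient.mk _ (jacobianMinor v a) := by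
  rw [Algebra.PreSubmersivePresentation.jacobian_eq_jacobiMatrix_det]
  have h : (Algebra.PreSubmersivePresentation.naive (v := v) a ha).jacobiMatrix =
      Matrix.of fun i j => pderiv (a i) (v j) := by
    ext i j : 1
    exact Algebra.PreSubmersivePresentation.jacobiMatrix_naive a ha _ _ i j
  rw [h]
  rfl

/-- Inverting a maximal minor of the Jacobian matrix gives a standard smooth algebra. -/
lemma isStandardSmooth_of_jacobianMinor (v : ι → MvPolynomial σ R) {a : ι → σ}
    (ha : Function.Injective a) {T : Type u} [CommRing T]
    [Algebra (MvPolynomial σ R ⧸ Ideal.span (Set.range v)) T] [Algebra R T]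
    [IsScalarTower R (MvPolynomial σ R ⧸ Ideal.span (Set.range v)) T]
    [IsLocalization.Away (Ideal.Quotient.mk (Ideal.span (Set.range v)) (jacobianMinor v a)) T] :
    Algebra.IsStandardSmoothOfRelativeDimension (Fintype.card σ - Fintype.card ι) R T := by
  let J : MvPolynomial σ R ⧸ Ideal.span (Set.range v) := Ideal.Quotient.mk _ (jacobianMinor v a)
  let P := Algebra.PreSubmersivePresentation.naive (v := v) a ha
  let Q := Algebra.SubmersivePresentation.localizationAway T J
  let W : Algebra.SubmersivePresentation R T (Unit ⊕ σ) (Unit ⊕ ι) :=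
    { __ := Q.toPreSubmersivePresentation.comp P
      jacobian_isUnit := by
        rw [Algebra.PreSubmersivePresentation.comp_jacobian_eq_jacobian_smul_jacobian,
          Algebra.smul_def, jacobian_naive]
        exact (IsLocalization.Away.algebraMap_isUnit J).mul Q.jacobian_isUnit }
  refine W.isStandardSmoothOfRelativeDimension ?_
  refine (Algebra.PreSubmersivePresentation.dimension_comp_eq_dimension_add_dimension
    Q.toPreSubmersivePresentation P).trans ?_
  simp [Algebra.Presentation.dimension]

/-- The Jacobian criterion: an algebra is locally standard smooth if the maximal minors of its
Jacobian matrix generate the unit ideal. -/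
lemma locally_isStandardSmooth_of_jacobianMinor (v : ι → MvPolynomial σ R) {κ : Type*}
    (a : κ → ι → σ) (ha : ∀ t, Function.Injective (a t))
    {I : Ideal (MvPolynomial σ R)} (hI : I = Ideal.span (Set.range v))
    (h : Ideal.span (Set.range fun t => Ideal.Quotient.mk I (jacobianMinor v (a t))) = ⊤) :
    RingHom.Locally
      (RingHom.IsStandardSmoothOfRelativeDimension (Fintype.card σ - Fintype.card ι))
      (algebraMap R (MvPolynomial σ R ⧸ I)) := by
  subst hI
  refine ⟨_, h, ?_⟩
  rintro _ ⟨t, rfl⟩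
  rw [← IsScalarTower.algebraMap_eq, RingHom.isStandardSmoothOfRelativeDimension_algebraMap]
  exact isStandardSmooth_of_jacobianMinor v (ha t)

end JacobianCriterion

section ChartSmooth

open MvPolynomial

/-- The transposed Jacobian matrix of the three quadrics at a point `x`. -/
def quadricGradient {B : Type*} [CommRing B] (x : Fin 5 → B) : Matrix (Fin 5) (Fin 3) B :=
  !![2 * x 1, x 4, 2 * x 0 + x 1;
     2 * x 0 + x 2, - x 3, x 0;
     x 1 + 2 * x 2, 0, - (2 * x 2);
     - (2 * x 3), - x 1, 0;
     0, x 0, 2 * x 4]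

/-- The variables other than `x_i` and the `t`-th of the remaining ones. -/
def minorColumns (i : Fin 5) (t : Fin 4) : Fin 3 → Fin 5 := i.succAbove ∘ t.succAbove

/-- The maximal minor of the Jacobian matrix of the three quadrics with respect to the variables
`minorColumns i t`. -/
def quadricMinor {B : Type*} [CommRing B] (x : Fin 5 → B) (i : Fin 5) (t : Fin 4) : B :=
  ((quadricGradient x).submatrix (minorColumns i t) id).det

/-- The equations of the chart `x_i = 1`. -/
def chartEquation (i : Fin 5) : Fin 4 → MvPolynomial (Fin 5) (ZMod 3) :=
  Fin.cons (X i - 1) quadric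

/-- The variable `x_i`, which belongs to the equation `x_i = 1`, followed by the variables
`minorColumns i t`. -/
def chartColumns (i : Fin 5) (t : Fin 4) : Fin 4 → Fin 5 := Fin.cons i (minorColumns i t)

lemma pderiv_quadric (i : Fin 5) (l : Fin 3) :
    pderiv i (quadric l) = quadricGradient X i l := by
  have h2 (j : Fin 5) : pderiv j (2 : MvPolynomial (Fin 5) (ZMod 3)) = 0 :=
    (pderiv j).map_natCast 2
  fin_cases i <;> fin_cases l <;>
    (simp [quadric, quadricGradient, pderiv_X, h2]; try ring)

/-- Expansion along the column of the equation `x_i = 1`. -/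
lemma jacobianMinor_chart (i : Fin 5) (t : Fin 4) :
    jacobianMinor (chartEquation i) (chartColumns i t) = quadricMinor X i t := by
  rw [jacobianMinor, Matrix.det_succ_column_zero, Fin.sum_univ_succ, Finset.sum_eq_zero]
  · simp only [chartEquation, chartColumns, Matrix.of_apply, Fin.cons_zero, map_sub,
      pderiv_X_self, Fin.val_zero, pow_zero, (pderiv i).map_one_eq_zero, sub_zero, one_mul,
      add_zero, quadricMinor]
    congr 1
    ext s l : 1
    simp [pderiv_quadric]
  · intro s _
    simp [chartEquation, chartColumns, pderiv_X, minorColumns]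

lemma map_quadricGradient {B T : Type*} [CommRing B] [CommRing T] (f : B →+* T) (x : Fin 5 → B)
    (i : Fin 5) (l : Fin 3) :
    f (quadricGradient x i l) = quadricGradient (fun j => f (x j)) i l := by
  fin_cases i <;> fin_cases l <;> simp [quadricGradient, map_ofNat f 2]

lemma mk_quadricMinor (i : Fin 5) (t : Fin 4) :
    Ideal.Quotient.mk (chartIdeal quadric i) (quadricMinor X i t) =
      quadricMinor (chartCoord i) i t := by
  rw [quadricMinor, RingHom.map_det]
  congr 1
  ext s l
  exact map_quadricGradient (Ideal.Quotient.mk (chartIdeal quadric i)) X _ l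

variable {B : Type*} [CommRing B] (x : Fin 5 → B)
  (h0 : 2 * x 0 * x 1 + x 2 * x 1 + x 2 ^ 2 - x 3 ^ 2 = 0) (h1 : x 4 * x 0 - x 3 * x 1 = 0)
  (h2 : x 0 ^ 2 + x 0 * x 1 - x 2 ^ 2 + x 4 ^ 2 = 0) (h3 : (3 : B) = 0)

include h0 h1 h2 h3

/-- The minors generate the unit ideal on the chart `x₂ = 1`. The coefficients solve a linear system
over `𝔽₃`; the coefficient of `h3` collects the multiples of three. -/
lemma one_eq_quadricMinor_one (h : x 1 = 1) :
    1 = (x 4 - x 3 - x 2 * x 3) * quadricMinor x 1 0 + (-x 4 - x 0 * x 3 + x 0 ^ 2 * x 3) *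
      quadricMinor x 1 1 + (x 0 * x 2 - x 0 ^ 2 + x 0 ^ 2 * x 2) * quadricMinor x 1 2 + (-1) *
      quadricMinor x 1 3 := by
  simp only [quadricMinor, Matrix.det_fin_three, quadricGradient]
  simp [minorColumns, Fin.succAbove, h]
  rw [h] at h0 h1 h2
  linear_combination (x 2 - x 0 - x 0 * x 4 ^ 2 - x 0 * x 2 - x 0 * x 2 ^ 2 - x 0 ^ 2
    + x 0 ^ 2 * x 4 ^ 2 - x 0 ^
    3 - x 0 ^ 4) * h0 + (-x 4 - x 2 * x 4 - x 2 * x 3 + x 0 * x 4 + x 0 * x 3 - x 0 ^ 2 * x 4) *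
    h1 + (1 + x 3 * x 4 + x 2 + x 0 + x 0 * x 2 - x 0 * x 2 ^ 2 - x 0 ^ 2 - x 0 ^ 3) * h2 + (-x
    4 ^ 2 - x 3 * x 4 + x 3 * x 4 ^ 3 - 2 * x 2 + x 2 * x 4 ^ 2 - x 2 * x 3 * x 4 - x 2 ^ 2 * x
    3 * x 4 - x 0 - 2 * x 0 * x 3 * x 4 + x 0 * x 3 ^ 2 * x 4 ^ 2 - 2 * x 0 * x 2 + x 0 * x 2 *
    x 4 ^ 2 - x 0 * x 2 * x 3 * x 4 + x 0 * x 2 * x 3 ^ 2 + x 0 * x 2 ^ 2 + 2 * x 0 * x 2 ^ 2 *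
    x 4 ^ 2 + x 0 * x 2 ^ 2 * x 3 ^ 2 + x 0 * x 2 ^ 3 - x 0 ^ 2 * x 3 * x 4 - x 0 ^ 2 * x 3 ^ 2
    - x 0 ^ 2 * x 3 ^ 2 * x 4 ^ 2 - x 0 ^ 2 * x 2 * x 4 ^ 2 - x 0 ^ 2 * x 2 ^ 2 + x 0 ^ 2 * x 2
    ^ 2 * x 4 ^ 2 + x 0 ^ 3 - x 0 ^ 3 * x 3 ^ 2 + x 0 ^ 3 * x 2 - 3 * x 0 ^ 3 * x 2 ^ 2 + 2 * x
    0 ^ 4 + x 0 ^ 4 * x 3 ^ 2 + x 0 ^ 4 * x 2 - x 0 ^ 4 * x 2 ^ 2 + x 0 ^ 5) * h3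

/-- The minors generate the unit ideal on the chart `x₃ = 1`. -/
lemma one_eq_quadricMinor_two (h : x 2 = 1) :
    1 = (x 1 * x 4) * quadricMinor x 2 1 + (1 - x 4 ^ 2 + x 3 ^ 2 - x 0 + x 0 * x 1) *
      quadricMinor x 2 2 + (x 3 * x 4 + x 1 + x 1 ^ 2 - x 0) * quadricMinor x 2 3 := by
  simp only [quadricMinor, Matrix.det_fin_three, quadricGradient]
  simp [minorColumns, Fin.succAbove, h]
  rw [h] at h0 h2
  linear_combination (x 4 ^ 2 - x 1 + x 1 ^ 2 + x 1 ^ 3 - x 0 * x 3 * x 4 + x 0 * x 1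
    + x 0 ^ 3) * h0 + (-x 4 - x
    4 ^ 3 + x 3 - x 1 * x 4 - x 0 * x 4 + x 0 * x 3 + x 0 * x 1 * x 4 - x 0 * x 1 * x 3 + x 0 ^
    2 * x 4) * h1 + (-1 + x 4 ^ 2 - x 1 + x 1 ^ 3 + x 0 * x 1 + x 0 ^ 2) * h2 + (x 4 ^ 2 - x 4 ^
    4 + x 3 ^ 2 * x 4 ^ 2 + x 1 * x 3 * x 4 - 3 * x 1 * x 3 * x 4 ^ 3 + 2 * x 1 * x 3 ^ 3 * x 4
    + x 1 ^ 2 * x 3 ^ 2 + x 1 ^ 3 * x 4 ^ 2 + x 1 ^ 3 * x 3 ^ 2 + x 0 * x 4 ^ 2 - x 0 * x 4 ^ 4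
    + 2 * x 0 * x 3 ^ 2 * x 4 ^ 2 + x 0 * x 3 ^ 3 * x 4 + x 0 * x 1 * x 3 ^ 2 + x 0 * x 1 ^ 2 +
    3 * x 0 * x 1 ^ 2 * x 3 * x 4 + x 0 * x 1 ^ 2 * x 3 ^ 2 - x 0 * x 1 ^ 4 - x 0 ^ 2 * x 4 ^ 2
    - x 0 ^ 2 * x 3 * x 4 - 2 * x 0 ^ 2 * x 3 ^ 2 + x 0 ^ 2 * x 1 * x 4 ^ 2 + 4 * x 0 ^ 2 * x 1
    * x 3 * x 4 + x 0 ^ 2 * x 1 ^ 3 - x 0 ^ 3 + x 0 ^ 3 * x 4 ^ 2 - x 0 ^ 3 * x 3 ^ 2 - 3 * x 0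
    ^ 3 * x 1 + x 0 ^ 4 - 2 * x 0 ^ 4 * x 1) * h3

omit h0 h1 h2 h3

/-- The chart `x_i = 1` is given by four equations in five variables. -/
lemma smooth_chartRing (i : Fin 5)
    (h : (1 : ChartRing quadric i) ∈ Ideal.span (Set.range (quadricMinor (chartCoord i) i))) :
    SmoothOfRelativeDimension 1
      (Spec.map (CommRingCat.ofHom (algebraMap (ZMod 3) (ChartRing quadric i)))) := by
  rw [HasRingHomProperty.Spec_iff (P := @SmoothOfRelativeDimension 1)]
  refine locally_isStandardSmooth_of_jacobianMinor
    (chartEquation i) (chartColumns i) (fun t => ?_) rfl ?_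
  · rw [chartColumns, Fin.cons_injective_iff]
    exact ⟨fun ⟨s, hs⟩ => i.succAbove_ne _ hs,
      i.succAbove_right_injective.comp t.succAbove_right_injective⟩
  · rw [Ideal.eq_top_iff_one]
    simpa only [jacobianMinor_chart, mk_quadricMinor] using h

lemma smooth_chartRing_one : SmoothOfRelativeDimension 1
    (Spec.map (CommRingCat.ofHom (algebraMap (ZMod 3) (ChartRing quadric 1)))) := by
  refine smooth_chartRing 1 ?_
  rw [one_eq_quadricMinor_one (chartCoord 1) (chartCoord_quadric_zero 1) (chartCoord_quadric_one 1)
    (chartCoord_quadric_two 1) (three_eq_zero_of_algebra _) (chartCoord_self 1)]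
  have h (t) := Ideal.subset_span (Set.mem_range_self (f := quadricMinor (chartCoord 1) 1) t)
  exact add_mem (add_mem (add_mem (Ideal.mul_mem_left _ _ (h 0)) (Ideal.mul_mem_left _ _ (h 1)))
    (Ideal.mul_mem_left _ _ (h 2))) (Ideal.mul_mem_left _ _ (h 3))

lemma smooth_chartRing_two : SmoothOfRelativeDimension 1
    (Spec.map (CommRingCat.ofHom (algebraMap (ZMod 3) (ChartRing quadric 2)))) := by
  refine smooth_chartRing 2 ?_
  rw [one_eq_quadricMinor_two (chartCoord 2) (chartCoord_quadric_zero 2) (chartCoord_quadric_one 2)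
    (chartCoord_quadric_two 2) (three_eq_zero_of_algebra _) (chartCoord_self 2)]
  have h (t) := Ideal.subset_span (Set.mem_range_self (f := quadricMinor (chartCoord 2) 2) t)
  exact add_mem (add_mem (Ideal.mul_mem_left _ _ (h 1)) (Ideal.mul_mem_left _ _ (h 2)))
    (Ideal.mul_mem_left _ _ (h 3))

theorem smooth_curve :
    SmoothOfRelativeDimension 1 (projStructure (coordinateGrading quadric)) := by
  have hopen (i) := isOpenImmersion_chartMap quadric quadric_isHomogeneous i
  let 𝒰 : curve.OpenCover := Scheme.Cover.mkOfCovers Bool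
    (fun b => Spec (.of (ChartRing quadric (if b then 1 else 2))))
    (fun b => chartMap quadric (if b then 1 else 2))
    (fun x => by
      have hr (i) := Set.ext_iff.mp (range_chartMap quadric quadric_isHomogeneous i) x
      rcases mem_basicOpen_or x with h | h
      · exact ⟨true, (hr 1).mpr h⟩
      · exact ⟨false, (hr 2).mpr h⟩) (fun _ => hopen _)
  -- instance search does not find this for the partially applied class
  have := HasRingHomProperty.instIsZariskiLocalAtSource (P := @SmoothOfRelativeDimension.{0} 1)
  refine (IsZariskiLocalAtSource.iff_of_openCover (P := @SmoothOfRelativeDimension.{0} 1) 𝒰).mpr ?_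
  rintro (_ | _)
  · change SmoothOfRelativeDimension 1 (chartMap quadric 2 ≫ _)
    rw [chartMap_structure]
    exact smooth_chartRing_two
  · change SmoothOfRelativeDimension 1 (chartMap quadric 1 ≫ _)
    rw [chartMap_structure]
    exact smooth_chartRing_one

end ChartSmooth

end GenusFive

end

theorem proposition1 :
    GenusFive.IsSmoothCurve GenusFive.CStructure ∧
      GenusFive.HasGenus GenusFive.CStructure 5 ∧
      Nat.card (GenusFive.RationalPoint GenusFive.CStructure) = 13 :=
  ⟨⟨GenusFive.isProper_projStructure GenusFive.quadric, GenusFive.smooth_curve,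
    GenusFive.geometricallyIrreducible_curve⟩, GenusFive.hasGenus_curve,
    GenusFive.card_rationalPoint_quadric⟩
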